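/- Let $0<s<1$. Let $t\subset\mathbb R^3$ be a closed non-degenerate tetrahedron with vertices $a_t,b_t,c_t,d_t$, let $\tau\subset\mathbb R^3$ be a closed non-degenerate triangle (panel) with vertices $a_\tau,b_\tau,c_\tau$, and let $n_\tau$ be a unit vector normal to $\tau$. Let $\varphi_i,\varphi_j:\mathbb R^3\to\mathbb R$ be continuous functions (for instance nodal basis functions of continuous piecewise linear finite elements) which on $t$ coincide with affine functions $\ell_i,\ell_j$, and suppose that $\tau\subset\partial(\operatorname{supp}\varphi_i\cup\operatorname{supp}\varphi_j)$. Put $$I_{t,\tau}=\int_t\int_\tau \varphi_i(x)\,\varphi_j(x)\,\frac{(y-x)^Tn_\tau}{|x-y|^{3+2s}}\,ds_y\,dx ,$$ where $ds_y$ is surface measure. Let $M_t=[b_t-a_t,\;c_t-b_t,\;d_t-b_t]$, $M_\tau=[b_\tau-a_\tau,\;c_\tau-b_\tau]$, $\chi_t(\tilde x)=M_t\tilde x+a_t$, $\chi_\tau(\tilde y)=M_\tau\tilde y+a_\tau$, and, for $(\tilde x,\tilde y)\in\mathbb R^3\times\mathbb R^2$ with $\chi_t(\tilde x)\ne\chi_\tau(\tilde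 y)$, $$\tilde k_2(\tilde x,\tilde y)=\ell_i(\chi_t(\tilde x))\,\ell_j(\chi_t(\tilde x))\,\frac{(\chi_\tau(\tilde y)-\chi_t(\tilde x))^Tn_\tau}{|\chi_t(\tilde x)-\chi_\tau(\tilde y)|^{3+2s}}\;|\det M_t|\;|(b_\tau-a_\tau)\times(c_\tau-b_\tau)| .$$ In each of the following three cases the integrand of $I_{t,\tau}$ is absolutely integrable over $t\times\tau$, the integrand $\tilde k_{2,V}$, $\tilde k_{2,E}$, $\tilde k_{2,F}$, respectively, is continuous on the closed unit cube over which it is integrated, and the stated formula holds. **Common vertex.** If $a_t=a_\tau$ and $t\cap\tau=\{a_t\}$, then $$I_{t,\tau}=\frac1{5-2s}\int_{[0,1]^4}\tilde k_{2,V}(\eta)\,d\eta,\qquad \tilde k_{2,V}(\eta)=\sum_{m=1}^2\tilde k_2(\mathscr D_m(\eta))\,J_m(\eta),$$ with $\mathscr D_1=\big((1,\eta_1\eta_2,\eta_1(1-\eta_2)),(\eta_3,\eta_3\eta_4)\big)$, $\mathscr D_2=\big((\eta_2,\eta_2\eta_3\eta_4,\eta_2\eta_3(1-\eta_4)),(1,\eta_1)\big)$,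 $J_1=\eta_1\eta_3$, $J_2=\eta_2^2\eta_3$. **Common edge.** If $a_t=a_\tau$, $b_t=b_\tau$ and $t\cap\tau$ is the segment $[a_t,b_t]$, then $$I_{t,\tau}=\frac1{5-2s}\,\frac1{4-2s}\int_{[0,1]^3}\tilde k_{2,E}(\eta)\,d\eta,\qquad \tilde k_{2,E}(\eta)=\sum_{m=1}^4\tilde k_2(\mathscr D_m(\eta))\,J_m(\eta),$$ with $\mathscr D_1=\big((0,\eta_1,1-\eta_1),(-\eta_2\eta_3,\eta_2(1-\eta_3))\big)$, $\mathscr D_2=\big((0,\eta_2\eta_3,\eta_2(1-\eta_3)),(-\eta_1,1-\eta_1)\big)$, $\mathscr D_3=\big((-\eta_2\eta_3,\eta_2(1-\eta_3),1-\eta_2),(0,\eta_1)\big)$, $\mathscr D_4=\big((-\eta_1\eta_2\eta_3,\eta_1\eta_2(1-\eta_3),\eta_1(1-\eta_2)),(0,1)\big)$, $J_1=J_2=J_3=\eta_2$, $J_4=\eta_1^2\eta_2$. **Common face.** If $a_t=a_\tau$, $b_t=b_\tau$ and $c_t=c_\tau$, then $$I_{t,\tau}=\prod_{j=0}^2\frac1{5-j-2s}\int_{[0,1]^2}\tilde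 k_{2,F}(\eta)\,d\eta,\qquad \tilde k_{2,F}(\eta)=\sum_{m=1}^9\tilde k_2(\mathscr D_m(\eta))\,J_m(\eta),$$ with $\mathscr D_1=\big((0,\eta_1,1-\eta_1),(-\eta_1\eta_2,0)\big)$, $\mathscr D_2=\big((0,\eta_1\eta_2,\eta_1(1-\eta_2)),(-1,0)\big)$, $\mathscr D_3=\big((0,\eta_1\eta_2,1-\eta_1\eta_2),(-\eta_1,0)\big)$, $\mathscr D_4=\big((0,0,1),(-\eta_1\eta_2,\eta_1(1-\eta_2))\big)$, $\mathscr D_5=\big((-\eta_1\eta_2,\eta_1(1-\eta_2),1-\eta_1),(0,0)\big)$, $\mathscr D_6=\big((-\eta_1,0,1-\eta_1),(0,\eta_1\eta_2)\big)$, $\mathscr D_7=\big((-\eta_1\eta_2,0,\eta_1(1-\eta_2)),(0,1)\big)$, $\mathscr D_8=\big((-\eta_1\eta_2,0,1-\eta_1\eta_2),(0,\eta_1)\big)$, $\mathscr D_9=\big((0,0,\eta_2),(-\eta_1,1-\eta_1)\big)$, $J_1=\dots=J_8=\eta_1$, $J_9=1$. -/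

import Mathlib

noncomputable section

namespace DuffyPanel

/-- Euclidean three-space. -/
abbrev E3 := EuclideanSpace ℝ (Fin 3)

/-- The closed tetrahedron with vertices `a, b, c, d = t 0, t 1, t 2, t 3`. -/
def tetra (t : Fin 4 → E3) : Set E3 := convexHull ℝ (Set.range t)

/-- The closed triangular panel with vertices `a, b, c = τ 0, τ 1, τ 2`. -/
def panel (τ : Fin 3 → E3) : Set E3 := convexHull ℝ (Set.range τ)

/-- `M_t = [b - a, c - b, d - b]` (columns). -/
def tetraMat (t : Fin 4 → E3) : Matrix (Fin 3) (Fin 3) ℝ :=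
  Matrix.of fun r k => (![t 1 - t 0, t 2 - t 1, t 3 - t 1] k) r

/-- `M_τ = [b - a, c - b]` (columns). -/
def panelMat (τ : Fin 3 → E3) : Matrix (Fin 3) (Fin 2) ℝ :=
  Matrix.of fun r k => (![τ 1 - τ 0, τ 2 - τ 1] k) r

/-- `χ_t(x̃) = M_t x̃ + a_t`. -/
def tetraChart (t : Fin 4 → E3) (x : Fin 3 → ℝ) : E3 :=
  WithLp.toLp 2 (Matrix.mulVec (tetraMat t) x) + t 0

/-- `χ_τ(ỹ) = M_τ ỹ + a_τ`. -/
def panelChart (τ : Fin 3 → E3) (y : Fin 2 → ℝ) : E3 :=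
  WithLp.toLp 2 (Matrix.mulVec (panelMat τ) y) + τ 0

/-- The Euclidean length of `(b_τ - a_τ) × (c_τ - b_τ)`. -/
def panelDet (τ : Fin 3 → E3) : ℝ :=
  ‖(WithLp.toLp 2
    (crossProduct (WithLp.ofLp (τ 1 - τ 0)) (WithLp.ofLp (τ 2 - τ 1))) : E3)‖

/-- The affine function `x ↦ α₁ x₁ + α₂ x₂ + α₃ x₃ + α₄`. -/
def affFun (α : Fin 4 → ℝ) (x : E3) : ℝ :=
  α 0 * x 0 + α 1 * x 1 + α 2 * x 2 + α 3

/-- `k₂(x, y) = φ(x) ψ(x) (y - x)ᵀ n / |x - y|^(3 + 2 s)`. -/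
def k2 (s : ℝ) (φ ψ : E3 → ℝ) (n : E3) (x y : E3) : ℝ :=
  φ x * ψ x * (inner ℝ (y - x) n / ‖x - y‖ ^ (3 + 2 * s))

/-- The surface measure of the panel: two-dimensional Hausdorff measure, normalised to agree with
Lebesgue measure on Euclidean planes. -/
def panelMeasure (τ : Fin 3 → E3) : MeasureTheory.Measure E3 :=
  (MeasureTheory.Measure.euclideanHausdorffMeasure 2).restrict (panel τ)

/-- `I_{t,τ} = ∫_t ∫_τ k₂(x, y) ds_y dx`. -/
def singularIntegral (s : ℝ) (φ ψ : E3 → ℝ) (n : E3) (t : Fin 4 → E3) (τ : Fin 3 → E3) : ℝ :=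
  ∫ x in tetra t, ∫ y, k2 s φ ψ n x y ∂(panelMeasure τ)

/-- The pulled-back integrand
`k̃₂(x̃, ỹ) = k₂(χ_t(x̃), χ_τ(ỹ)) |det M_t| |(b_τ - a_τ) × (c_τ - b_τ)|`, in which the basis functions
enter through the coefficients `α`, `β` of their affine expressions on `t`. It is defined for all
`(x̃, ỹ) ∈ ℝ³ × ℝ²`, not only on the reference elements. -/
def k2Ref (s : ℝ) (α β : Fin 4 → ℝ) (n : E3) (t : Fin 4 → E3) (τ : Fin 3 → E3)
    (p : (Fin 3 → ℝ) × (Fin 2 → ℝ)) : ℝ :=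
  k2 s (affFun α) (affFun β) n (tetraChart t p.1) (panelChart τ p.2)
    * |(tetraMat t).det| * panelDet τ

/-! In what follows `η i` is the coordinate written `η_{i+1}` in one-based indexing, and the index `m` is shifted in
the same way. -/

/-- Common vertex: the maps `D_1, D_2`. The full transformation is `ξ D_m(η)`. -/
def duffyVertex (η : Fin 4 → ℝ) : Fin 2 → (Fin 3 → ℝ) × (Fin 2 → ℝ) :=
  ![(![1, η 0 * η 1, η 0 * (1 - η 1)], ![η 2, η 2 * η 3]),
    (![η 1, η 1 * η 2 * η 3, η 1 * η 2 * (1 - η 3)], ![1, η 0])]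

/-- Common vertex: the `η`-part of the Jacobi determinants `ξ⁴ J_m(η)`. -/
def jacVertex (η : Fin 4 → ℝ) : Fin 2 → ℝ :=
  ![η 0 * η 2, η 1 ^ 2 * η 2]

/-- Common edge: the maps `D_1, …, D_4`. The full transformation is
`ξ₁ (e₁, ê₁) + ξ₁ ξ₂ D_m(η)`. -/
def duffyEdge (η : Fin 3 → ℝ) : Fin 4 → (Fin 3 → ℝ) × (Fin 2 → ℝ) :=
  ![(![0, η 0, 1 - η 0], ![-(η 1 * η 2), η 1 * (1 - η 2)]),
    (![0, η 1 * η 2, η 1 * (1 - η 2)], ![-η 0, 1 - η 0]),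
    (![-(η 1 * η 2), η 1 * (1 - η 2), 1 - η 1], ![0, η 0]),
    (![-(η 0 * η 1 * η 2), η 0 * η 1 * (1 - η 2), η 0 * (1 - η 1)], ![0, 1])]

/-- Common edge: the `η`-part of the Jacobi determinants `ξ₁⁴ ξ₂³ J_m(η)`. -/
def jacEdge (η : Fin 3 → ℝ) : Fin 4 → ℝ :=
  ![η 1, η 1, η 1, η 0 ^ 2 * η 1]

/-- Common face: the maps `D_1, …, D_9`. The full transformation is
`ξ₁ (e₁, ê₁) + ξ₁ (1 - ξ₂) (e₂, ê₂) + ξ₁ ξ₂ ξ₃ D_m(η)`. -/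
def duffyFace (η : Fin 2 → ℝ) : Fin 9 → (Fin 3 → ℝ) × (Fin 2 → ℝ) :=
  ![(![0, η 0, 1 - η 0], ![-(η 0 * η 1), 0]),
    (![0, η 0 * η 1, η 0 * (1 - η 1)], ![-1, 0]),
    (![0, η 0 * η 1, 1 - η 0 * η 1], ![-η 0, 0]),
    (![0, 0, 1], ![-(η 0 * η 1), η 0 * (1 - η 1)]),
    (![-(η 0 * η 1), η 0 * (1 - η 1), 1 - η 0], ![0, 0]),
    (![-η 0, 0, 1 - η 0], ![0, η 0 * η 1]),
    (![-(η 0 * η 1), 0, η 0 * (1 - η 1)], ![0, 1]),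
    (![-(η 0 * η 1), 0, 1 - η 0 * η 1], ![0, η 0]),
    (![0, 0, η 1], ![-η 0, 1 - η 0])]

/-- Common face: the `η`-part of the Jacobi determinants `ξ₁⁴ ξ₂³ ξ₃² J_m(η)`. -/
def jacFace (η : Fin 2 → ℝ) : Fin 9 → ℝ :=
  ![η 0, η 0, η 0, η 0, η 0, η 0, η 0, η 0, 1]

/-- `k̃_{2,V}(η) = ∑_m k̃₂(D_m(η)) J_m(η)`. -/
def k2Vertex (s : ℝ) (α β : Fin 4 → ℝ) (n : E3) (t : Fin 4 → E3) (τ : Fin 3 → E3)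
    (η : Fin 4 → ℝ) : ℝ :=
  ∑ m : Fin 2, k2Ref s α β n t τ (duffyVertex η m) * jacVertex η m

/-- `k̃_{2,E}(η) = ∑_m k̃₂(D_m(η)) J_m(η)`. -/
def k2Edge (s : ℝ) (α β : Fin 4 → ℝ) (n : E3) (t : Fin 4 → E3) (τ : Fin 3 → E3)
    (η : Fin 3 → ℝ) : ℝ :=
  ∑ m : Fin 4, k2Ref s α β n t τ (duffyEdge η m) * jacEdge η m

/-- `k̃_{2,F}(η) = ∑_m k̃₂(D_m(η)) J_m(η)`. -/
def k2Face (s : ℝ) (α β : Fin 4 → ℝ) (n : E3) (t : Fin 4 → E3) (τ : Fin 3 → E3)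
    (η : Fin 2 → ℝ) : ℝ :=
  ∑ m : Fin 9, k2Ref s α β n t τ (duffyFace η m) * jacFace η m

end DuffyPanel

end

noncomputable section

namespace DuffyPanel

open MeasureTheory Set

/-! Affine charts pull the integral back to the product of a reference tetrahedron and a reference
triangle in `ℝ⁵` (`singularIntegral_eq_ref`). The panel lies in the frontier of the union of the two
supports, so by continuity both basis functions vanish on it. Their affine expressions on `t`
therefore vanish at every shared vertex. Hence the pulled-back kernel is unchanged when both
reference points move along a shared direction. In the remaining variables it is homogeneous of
degree `1 + 1 + 1 - (3 + 2s) = -2s` (`k2Ref_scale`).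

Up to a null set the product of the reference elements splits into cells, according to which of
certain linear forms are larger. A unimodular integer matrix carries each cell to a set in which
every coordinate runs between `0` and an earlier one. Such a set is parametrised by the cube through
monomials (`IsCubeParam.snoc`). In these coordinates a point is a shared part plus a product of
radial variables times `D_m(η)`, so homogeneity pulls out pure powers of the radial variables. The
Jacobian exponents `4, 3, 2`, each lowered by `2s`, integrate to `1/(5-2s)`, `1/(4-2s)`, `1/(3-2s)`
(`rpow_mul_tail`).

What is left is continuous on a compact cube, because the two charts never meet at `D_m(η)`
(`chart_ne_vertex`, `chart_ne_edge`, `chart_ne_face`). Absolute integrability comes from the same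
computation, since the cell decomposition is an identity of measures
(`integrable_and_integral_of_lintegral_eq_sum`). -/

/-! ### Monomial parametrisations by the unit cube. -/

theorem setLIntegral_Icc_scale {c : ℝ} (hc : 0 ≤ c) {g : ℝ → ENNReal} (hg : Measurable g) :
    ∫⁻ a in Icc 0 c, g a = ENNReal.ofReal c * ∫⁻ b in Icc (0 : ℝ) 1, g (c * b) := by
  rcases hc.eq_or_lt with rfl | hc
  · simp
  conv_lhs => rw [← Real.smul_map_volume_mul_left hc.ne', Measure.restrict_smul,
    lintegral_smul_measure, setLIntegral_map measurableSet_Icc hg (by fun_prop)]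
  have : (fun x => c * x) ⁻¹' Icc 0 c = Icc (0 : ℝ) 1 := by
    ext x
    simp only [mem_preimage, mem_Icc]
    constructor
    · rintro ⟨h1, h2⟩
      exact ⟨by nlinarith, by nlinarith⟩
    · rintro ⟨h1, h2⟩
      exact ⟨by nlinarith, by nlinarith⟩
  rw [this, abs_of_pos hc, smul_eq_mul]

/-- `Φ`, with Jacobi determinant `J`, parametrises the set `P` of nonnegative vectors by the unit
cube. -/
structure IsCubeParam {n : ℕ} (P : Set (Fin n → ℝ)) (Φ : (Fin n → ℝ) → Fin n → ℝ)
    (J : (Fin n → ℝ) → ℝ) : Prop where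
  measurable_map : Measurable Φ
  measurable_jac : Measurable J
  measurableSet : MeasurableSet P
  nonneg : ∀ w ∈ P, ∀ i, 0 ≤ w i
  jac_nonneg : ∀ p ∈ Icc (0 : Fin n → ℝ) 1, 0 ≤ J p
  map_nonneg : ∀ p ∈ Icc (0 : Fin n → ℝ) 1, ∀ i, 0 ≤ Φ p i
  lintegral_eq : ∀ f : (Fin n → ℝ) → ENNReal, Measurable f →
    ∫⁻ w in P, f w = ∫⁻ p in Icc (0 : Fin n → ℝ) 1, ENNReal.ofReal (J p) * f (Φ p)

theorem IsCubeParam.one : IsCubeParam (Icc (0 : Fin 1 → ℝ) 1) id (fun _ => 1) where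
  measurable_map := measurable_id
  measurable_jac := measurable_const
  measurableSet := measurableSet_Icc
  nonneg _ hw i := hw.1 i
  jac_nonneg _ _ := zero_le_one
  map_nonneg _ hw i := hw.1 i
  lintegral_eq f _ := by simp

theorem lintegral_snoc {n : ℕ} {f : (Fin (n + 1) → ℝ) → ENNReal} (hf : Measurable f) :
    ∫⁻ w, f w = ∫⁻ v : Fin n → ℝ, ∫⁻ a : ℝ, f (Fin.snoc v a : Fin (n + 1) → ℝ) := by
  have e := (volume_preserving_piFinSuccAbove (fun _ : Fin (n + 1) => ℝ) (Fin.last n)).symm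
  rw [← e.lintegral_comp hf, Measure.volume_eq_prod]
  refine (lintegral_prod_symm _ (hf.comp e.measurable).aemeasurable).trans ?_
  simp [MeasurableEquiv.piFinSuccAbove, Fin.insertNthEquiv, Fin.insertNth_last']

theorem measurable_snoc {n : ℕ} :
    Measurable fun q : (Fin n → ℝ) × ℝ => (Fin.snoc q.1 q.2 : Fin (n + 1) → ℝ) := by
  refine measurable_pi_lambda _ fun i => ?_
  refine Fin.lastCases ?_ (fun j => ?_) i
  · simpa using measurable_snd
  · simpa [Function.comp_def] using (measurable_pi_apply (X := fun _ : Fin n => ℝ) j).comp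
      (measurable_fst (β := ℝ))

theorem measurable_init {n : ℕ} :
    Measurable fun q : Fin (n + 1) → ℝ => (Fin.init q : Fin n → ℝ) :=
  measurable_pi_lambda _ fun i => measurable_pi_apply (i.castSucc)

theorem mem_Icc_iff_init {n : ℕ} {p : Fin (n + 1) → ℝ} :
    p ∈ Icc (0 : Fin (n + 1) → ℝ) 1 ↔
      (Fin.init p : Fin n → ℝ) ∈ Icc (0 : Fin n → ℝ) 1 ∧ p (Fin.last n) ∈ Icc (0 : ℝ) 1 := by
  simp only [mem_Icc, Pi.le_def, Fin.forall_fin_succ', Fin.init, Pi.zero_apply, Pi.one_apply]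
  tauto

/-- Adjoin a coordinate ranging between `0` and the `i`-th coordinate. -/
theorem IsCubeParam.snoc {n : ℕ} {P : Set (Fin n → ℝ)} {Φ : (Fin n → ℝ) → Fin n → ℝ}
    {J : (Fin n → ℝ) → ℝ} (h : IsCubeParam P Φ J) (i : Fin n) :
    IsCubeParam {w : Fin (n + 1) → ℝ | (Fin.init w : Fin n → ℝ) ∈ P ∧
        0 ≤ w (Fin.last n) ∧ w (Fin.last n) ≤ w i.castSucc}
      (fun p => (Fin.snoc (Φ (Fin.init p)) (Φ (Fin.init p) i * p (Fin.last n)) : Fin (n + 1) → ℝ))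
      (fun p => J (Fin.init p) * Φ (Fin.init p) i) := by
  have hΦ := h.measurable_map
  have hJ := h.measurable_jac
  have hi := measurable_init (n := n)
  have hΦi : Measurable fun v => Φ v i := (measurable_pi_apply i).comp hΦ
  have hS : MeasurableSet {w : Fin (n + 1) → ℝ | (Fin.init w : Fin n → ℝ) ∈ P ∧
        0 ≤ w (Fin.last n) ∧ w (Fin.last n) ≤ w i.castSucc} :=
    (hi h.measurableSet).inter ((measurableSet_le measurable_const (measurable_pi_apply _)).inter
      (measurableSet_le (measurable_pi_apply _) (measurable_pi_apply _)))
  have hmap : Measurable fun p : Fin (n + 1) → ℝ =>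
      (Fin.snoc (Φ (Fin.init p)) (Φ (Fin.init p) i * p (Fin.last n)) : Fin (n + 1) → ℝ) :=
    measurable_snoc.comp ((hΦ.comp hi).prodMk ((hΦi.comp hi).mul (measurable_pi_apply _)))
  have hjac : Measurable fun p : Fin (n + 1) → ℝ => J (Fin.init p) * Φ (Fin.init p) i :=
    (hJ.comp hi).mul (hΦi.comp hi)
  refine ⟨hmap, hjac, hS, ?_, ?_, ?_, ?_⟩
  · rintro w ⟨h1, h2, -⟩ j
    refine Fin.lastCases h2 (fun k => h.nonneg _ h1 k) j
  · intro p hp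
    rw [mem_Icc_iff_init] at hp
    exact mul_nonneg (h.jac_nonneg _ hp.1) (h.map_nonneg _ hp.1 i)
  · intro p hp j
    rw [mem_Icc_iff_init] at hp
    refine Fin.lastCases ?_ (fun k => ?_) j
    · simpa using mul_nonneg (h.map_nonneg _ hp.1 i) hp.2.1
    · simpa using h.map_nonneg _ hp.1 k
  · intro f hf
    have hfull : Measurable fun p : Fin (n + 1) → ℝ =>
        ENNReal.ofReal (J (Fin.init p) * Φ (Fin.init p) i) *
        f (Fin.snoc (Φ (Fin.init p)) (Φ (Fin.init p) i * p (Fin.last n)) : Fin (n + 1) → ℝ) :=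
      hjac.ennreal_ofReal.mul (hf.comp hmap)
    rw [← lintegral_indicator hS, lintegral_snoc (hf.indicator hS),
      ← lintegral_indicator measurableSet_Icc,
      lintegral_snoc (hfull.indicator measurableSet_Icc)]
    -- Over `v ∈ P` the slice is `[0, v i]`; rescaling it to `[0, 1]` costs the factor `v i`, which
    -- becomes the new Jacobian factor `Φ v i`.
    have hL : ∀ v : Fin n → ℝ, ∫⁻ a : ℝ, ({w : Fin (n + 1) → ℝ | (Fin.init w : Fin n → ℝ) ∈ P ∧
        0 ≤ w (Fin.last n) ∧ w (Fin.last n) ≤ w i.castSucc}.indicator f)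
          (Fin.snoc v a : Fin (n + 1) → ℝ) = P.indicator (fun v => ENNReal.ofReal (v i) *
            ∫⁻ b in Icc (0 : ℝ) 1, f (Fin.snoc v (v i * b) : Fin (n + 1) → ℝ)) v := by
      intro v
      by_cases hv : v ∈ P
      · rw [indicator_of_mem hv, ← setLIntegral_Icc_scale (h.nonneg v hv i)
          (g := fun a => f (Fin.snoc v a : Fin (n + 1) → ℝ))
          (hf.comp (measurable_snoc.comp (measurable_const.prodMk measurable_id))),
          ← lintegral_indicator measurableSet_Icc]
        refine lintegral_congr fun a => ?_
        simp [indicator, hv]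
      · rw [indicator_of_notMem hv, lintegral_eq_zero_of_ae_eq_zero]
        refine .of_forall fun a => ?_
        simp [hv]
    have hR : ∀ v : Fin n → ℝ, ∫⁻ a : ℝ, ((Icc (0 : Fin (n + 1) → ℝ) 1).indicator (fun p =>
        ENNReal.ofReal (J (Fin.init p) * Φ (Fin.init p) i) *
        f (Fin.snoc (Φ (Fin.init p)) (Φ (Fin.init p) i * p (Fin.last n)) : Fin (n + 1) → ℝ)))
          (Fin.snoc v a : Fin (n + 1) → ℝ) = (Icc (0 : Fin n → ℝ) 1).indicator (fun v =>
          ENNReal.ofReal (J v) * (ENNReal.ofReal (Φ v i) * ∫⁻ b in Icc (0 : ℝ) 1,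
            f (Fin.snoc (Φ v) (Φ v i * b) : Fin (n + 1) → ℝ))) v := by
      intro v
      by_cases hv : v ∈ Icc (0 : Fin n → ℝ) 1
      · rw [indicator_of_mem hv, ← mul_assoc, ← ENNReal.ofReal_mul (h.jac_nonneg v hv),
          ← lintegral_const_mul' _ _ ENNReal.ofReal_ne_top,
          ← lintegral_indicator measurableSet_Icc]
        refine lintegral_congr fun a => ?_
        simp only [indicator, mem_Icc_iff_init, Fin.init_snoc, Fin.snoc_last, hv, true_and]
      · rw [indicator_of_notMem hv, lintegral_eq_zero_of_ae_eq_zero]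
        refine .of_forall fun a => ?_
        simp only [indicator, mem_Icc_iff_init, Fin.init_snoc, hv, false_and, if_false,
          Pi.zero_apply]
    simp_rw [hL, hR]
    rw [lintegral_indicator h.measurableSet, lintegral_indicator measurableSet_Icc, h.lintegral_eq]
    refine ((measurable_pi_apply i).ennreal_ofReal).mul ?_
    refine Measurable.lintegral_prod_right' (f := fun q : (Fin n → ℝ) × ℝ =>
      f (Fin.snoc q.1 (q.1 i * q.2) : Fin (n + 1) → ℝ)) ?_
    exact hf.comp (measurable_snoc.comp (measurable_fst.prodMk
      (((measurable_pi_apply i).comp measurable_fst).mul measurable_snd)))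

/-! ### Unimodular changes of coordinates and separation of the radial powers. -/

/-- Change coordinates by a unimodular integer matrix. -/
theorem measurePreserving_mulVec {n : ℕ} {A B : Matrix (Fin n) (Fin n) ℤ} (h : A * B = 1) :
    MeasurePreserving (fun x : Fin n → ℝ => (B.map (Int.cast : ℤ → ℝ)).mulVec x) := by
  have hdet : |(B.map (Int.cast : ℤ → ℝ)).det| = 1 := by
    have h1 : A.det * B.det = 1 := by rw [← Matrix.det_mul, h, Matrix.det_one]
    have h2 : |B.det| = 1 := Int.isUnit_iff_abs_eq.mp (IsUnit.of_mul_eq_one_right _ h1)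
    have h3 : (B.map (Int.cast : ℤ → ℝ)).det = (B.det : ℝ) := by
      simpa using ((Int.castRingHom ℝ).map_det B).symm
    rw [h3]
    exact_mod_cast h2
  have h0 : (B.map (Int.cast : ℤ → ℝ)).det ≠ 0 := fun h => by simp [h] at hdet
  refine ⟨by fun_prop, ?_⟩
  have := Real.map_matrix_volume_pi_eq_smul_volume_pi h0
  rw [abs_inv, hdet] at this
  rw [inv_one, ENNReal.ofReal_one, one_smul] at this
  exact this

/-- The cube formula is applied to `f ∘ A` and transported along the volume-preserving map `B`. Here
`B` leads from the original to the sorted coordinates and `A` leads back. -/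
theorem IsCubeParam.lintegral_mulVec {n : ℕ} {P : Set (Fin n → ℝ)} {Φ : (Fin n → ℝ) → Fin n → ℝ}
    {J : (Fin n → ℝ) → ℝ} (h : IsCubeParam P Φ J) {A B : Matrix (Fin n) (Fin n) ℤ}
    (hAB : A * B = 1) {f : (Fin n → ℝ) → ENNReal} (hf : Measurable f) :
    ∫⁻ x in {x | (B.map (Int.cast : ℤ → ℝ)).mulVec x ∈ P}, f x =
      ∫⁻ p in Icc (0 : Fin n → ℝ) 1,
        ENNReal.ofReal (J p) * f ((A.map (Int.cast : ℤ → ℝ)).mulVec (Φ p)) := by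
  have hA : Measurable fun x : Fin n → ℝ => (A.map (Int.cast : ℤ → ℝ)).mulVec x := by fun_prop
  refine Eq.trans ?_ (h.lintegral_eq _ (hf.comp hA))
  rw [← (measurePreserving_mulVec hAB).setLIntegral_comp_preimage h.measurableSet (hf.comp hA)]
  refine lintegral_congr fun x => ?_
  have : (A.map (Int.cast : ℤ → ℝ)) * (B.map (Int.cast : ℤ → ℝ)) = 1 := by
    have := congrArg (Int.castRingHom ℝ).mapMatrix hAB
    rwa [map_mul, map_one] at this
  simp [Matrix.mulVec_mulVec, this]

theorem mem_Icc_iff_tail {n : ℕ} {p : Fin (n + 1) → ℝ} :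
    p ∈ Icc (0 : Fin (n + 1) → ℝ) 1 ↔
      p 0 ∈ Icc (0 : ℝ) 1 ∧ (Fin.tail p : Fin n → ℝ) ∈ Icc (0 : Fin n → ℝ) 1 := by
  simp only [mem_Icc, Pi.le_def, Fin.forall_fin_succ, Fin.tail, Pi.zero_apply, Pi.one_apply]
  tauto

/-- Fubini in the zeroth coordinate. Each use removes one radial variable, and the bound on `e` is
exactly what makes its power integrable at `0`. -/
theorem rpow_mul_tail {n : ℕ} {g : (Fin n → ℝ) → ℝ} (hg : IntegrableOn g (Icc 0 1)) {e : ℝ}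
    (he : -1 < e) :
    IntegrableOn (fun p : Fin (n + 1) → ℝ => p 0 ^ e * g (Fin.tail p)) (Icc 0 1) ∧
      ∫ p in Icc (0 : Fin (n + 1) → ℝ) 1, p 0 ^ e * g (Fin.tail p) =
        1 / (e + 1) * ∫ q in Icc (0 : Fin n → ℝ) 1, g q := by
  have ep := (volume_preserving_piFinSuccAbove (fun _ : Fin (n + 1) => ℝ) 0)
  have hpre : (MeasurableEquiv.piFinSuccAbove (fun _ : Fin (n + 1) => ℝ) 0) ⁻¹'
      (Icc (0 : ℝ) 1 ×ˢ Icc (0 : Fin n → ℝ) 1) = Icc 0 1 := by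
    ext p
    rw [mem_Icc_iff_tail]
    rfl
  have hint : IntegrableOn (fun x : ℝ => x ^ e) (Icc 0 1) := by
    rw [integrableOn_Icc_iff_integrableOn_Ioc,
      ← intervalIntegrable_iff_integrableOn_Ioc_of_le zero_le_one]
    exact intervalIntegral.intervalIntegrable_rpow' he
  constructor
  · have := (ep.integrableOn_comp_preimage (MeasurableEquiv.measurableEmbedding _)
      (s := Icc (0 : ℝ) 1 ×ˢ Icc (0 : Fin n → ℝ) 1)
      (f := fun q : ℝ × (Fin n → ℝ) => q.1 ^ e * g q.2)).mpr (by
        rw [IntegrableOn, Measure.volume_eq_prod, ← Measure.prod_restrict]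
        exact Integrable.mul_prod hint hg)
    rw [hpre] at this
    exact this
  · have := ep.setIntegral_preimage_emb (MeasurableEquiv.measurableEmbedding _)
      (fun q : ℝ × (Fin n → ℝ) => q.1 ^ e * g q.2) (Icc (0 : ℝ) 1 ×ˢ Icc (0 : Fin n → ℝ) 1)
    rw [hpre, Measure.volume_eq_prod, setIntegral_prod_mul (fun x : ℝ => x ^ e) g,
      integral_Icc_eq_integral_Ioc (f := fun x : ℝ => x ^ e),
      ← intervalIntegral.integral_of_le zero_le_one, integral_rpow (Or.inl he)] at this
    rw [Real.one_rpow, Real.zero_rpow (by linarith), sub_zero] at this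
    exact this

/-! ### The nested sets in dimension five that occur as cells. -/

/-- Vectors with `0 ≤ w 0 ≤ 1` and the other coordinates between `0` and an earlier coordinate. -/
def nested (a b c d : Fin 5) : Set (Fin 5 → ℝ) :=
  {w | 0 ≤ w 0 ∧ w 0 ≤ 1 ∧ 0 ≤ w 1 ∧ w 1 ≤ w a ∧ 0 ≤ w 2 ∧ w 2 ≤ w b ∧
    0 ≤ w 3 ∧ w 3 ≤ w c ∧ 0 ≤ w 4 ∧ w 4 ≤ w d}

theorem mem_nested {a b c d : Fin 5} {w : Fin 5 → ℝ} : w ∈ nested a b c d ↔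
    0 ≤ w 0 ∧ w 0 ≤ 1 ∧ 0 ≤ w 1 ∧ w 1 ≤ w a ∧ 0 ≤ w 2 ∧ w 2 ≤ w b ∧
    0 ≤ w 3 ∧ w 3 ≤ w c ∧ 0 ≤ w 4 ∧ w 4 ≤ w d :=
  Iff.rfl

/-- The map parametrising `nested 0 1 0 3` by the cube. -/
def twoChainsMap (p : Fin 5 → ℝ) : Fin 5 → ℝ :=
  ![p 0, p 0 * p 1, p 0 * p 1 * p 2, p 0 * p 3, p 0 * p 3 * p 4]

/-- The Jacobi determinant of `twoChainsMap`. -/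
def twoChainsJac (p : Fin 5 → ℝ) : ℝ := p 0 * (p 0 * p 1) * p 0 * (p 0 * p 3)

/-- Coordinates are adjoined one at a time: the arguments of `snoc` are the indices of `nested`. The
other shapes arise in the same way. -/
theorem isCubeParam_twoChains : IsCubeParam (nested 0 1 0 3) twoChainsMap twoChainsJac := by
  convert (((IsCubeParam.one.snoc 0).snoc 1).snoc 0).snoc 3 using 1
  · ext w
    simp [nested, Fin.init, Pi.le_def, and_assoc]
  · ext p i
    fin_cases i <;> simp [twoChainsMap, Fin.init, Fin.snoc]
  · ext p
    simp [twoChainsJac, Fin.init, Fin.snoc]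

/-- The map parametrising `nested 0 0 2 3` by the cube. -/
def shortLongChainMap (p : Fin 5 → ℝ) : Fin 5 → ℝ :=
  ![p 0, p 0 * p 1, p 0 * p 2, p 0 * p 2 * p 3, p 0 * p 2 * p 3 * p 4]

/-- The Jacobi determinant of `shortLongChainMap`. -/
def shortLongChainJac (p : Fin 5 → ℝ) : ℝ := p 0 * p 0 * (p 0 * p 2) * (p 0 * p 2 * p 3)

theorem isCubeParam_shortLongChain : IsCubeParam (nested 0 0 2 3) shortLongChainMap shortLongChainJac := by
  convert (((IsCubeParam.one.snoc 0).snoc 0).snoc 2).snoc 3 using 1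
  · ext w
    simp [nested, Fin.init, Pi.le_def, and_assoc]
  · ext p i
    fin_cases i <;> simp [shortLongChainMap, Fin.init, Fin.snoc]
  · ext p
    simp [shortLongChainJac, Fin.init, Fin.snoc]

/-- The map parametrising `nested 0 1 1 3` by the cube. -/
def lateBranchMap (p : Fin 5 → ℝ) : Fin 5 → ℝ :=
  ![p 0, p 0 * p 1, p 0 * p 1 * p 2, p 0 * p 1 * p 3, p 0 * p 1 * p 3 * p 4]

/-- The Jacobi determinant of `lateBranchMap`. -/
def lateBranchJac (p : Fin 5 → ℝ) : ℝ := p 0 * (p 0 * p 1) * (p 0 * p 1) * (p 0 * p 1 * p 3)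

theorem isCubeParam_lateBranch : IsCubeParam (nested 0 1 1 3) lateBranchMap lateBranchJac := by
  convert (((IsCubeParam.one.snoc 0).snoc 1).snoc 1).snoc 3 using 1
  · ext w
    simp [nested, Fin.init, Pi.le_def, and_assoc]
  · ext p i
    fin_cases i <;> simp [lateBranchMap, Fin.init, Fin.snoc]
  · ext p
    simp [lateBranchJac, Fin.init, Fin.snoc]

/-- The map parametrising `nested 0 1 2 3` by the cube. -/
def chainMap (p : Fin 5 → ℝ) : Fin 5 → ℝ :=
  ![p 0, p 0 * p 1, p 0 * p 1 * p 2, p 0 * p 1 * p 2 * p 3,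
      p 0 * p 1 * p 2 * p 3 * p 4]

/-- The Jacobi determinant of `chainMap`. -/
def chainJac (p : Fin 5 → ℝ) : ℝ := p 0 * (p 0 * p 1) * (p 0 * p 1 * p 2) * (p 0 * p 1 * p 2 * p 3)

theorem isCubeParam_chain : IsCubeParam (nested 0 1 2 3) chainMap chainJac := by
  convert (((IsCubeParam.one.snoc 0).snoc 1).snoc 2).snoc 3 using 1
  · ext w
    simp [nested, Fin.init, Pi.le_def, and_assoc]
  · ext p i
    fin_cases i <;> simp [chainMap, Fin.init, Fin.snoc]
  · ext p
    simp [chainJac, Fin.init, Fin.snoc]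

/-- The map parametrising `nested 0 1 2 2` by the cube. -/
def forkMap (p : Fin 5 → ℝ) : Fin 5 → ℝ :=
  ![p 0, p 0 * p 1, p 0 * p 1 * p 2, p 0 * p 1 * p 2 * p 3,
      p 0 * p 1 * p 2 * p 4]

/-- The Jacobi determinant of `forkMap`. -/
def forkJac (p : Fin 5 → ℝ) : ℝ := p 0 * (p 0 * p 1) * (p 0 * p 1 * p 2) * (p 0 * p 1 * p 2)

theorem isCubeParam_fork : IsCubeParam (nested 0 1 2 2) forkMap forkJac := by
  convert (((IsCubeParam.one.snoc 0).snoc 1).snoc 2).snoc 2 using 1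
  · ext w
    simp [nested, Fin.init, Pi.le_def, and_assoc]
  · ext p i
    fin_cases i <;> simp [forkMap, Fin.init, Fin.snoc]
  · ext p
    simp [forkJac, Fin.init, Fin.snoc]

/-! ### Reference elements and their decomposition into cells. -/

/-- The reference tetrahedron of `tetraChart`. -/
def refTetra : Set (Fin 3 → ℝ) := {x | 0 ≤ x 1 ∧ 0 ≤ x 2 ∧ x 1 + x 2 ≤ x 0 ∧ x 0 ≤ 1}

/-- The reference triangle of `panelChart`. -/
def refPanel : Set (Fin 2 → ℝ) := {y | 0 ≤ y 1 ∧ y 1 ≤ y 0 ∧ y 0 ≤ 1}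

theorem measurableSet_refTetra : MeasurableSet refTetra := by
  simp only [refTetra, ofPred_and]
  exact (measurableSet_le (by fun_prop) (by fun_prop)).inter <|
    (measurableSet_le (by fun_prop) (by fun_prop)).inter <|
    (measurableSet_le (by fun_prop) (by fun_prop)).inter <|
    measurableSet_le (by fun_prop) (by fun_prop)

theorem measurableSet_refPanel : MeasurableSet refPanel := by
  simp only [refPanel, ofPred_and]
  exact (measurableSet_le (by fun_prop) (by fun_prop)).inter <|
    (measurableSet_le (by fun_prop) (by fun_prop)).inter <|
    measurableSet_le (by fun_prop) (by fun_prop)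

/-- Split `ℝ⁵` into `ℝ³ × ℝ²`. -/
def splitCoords (x : Fin 5 → ℝ) : (Fin 3 → ℝ) × (Fin 2 → ℝ) := (![x 0, x 1, x 2], ![x 3, x 4])

theorem measurePreserving_splitCoords : MeasurePreserving splitCoords := by
  have h1 := (volume_measurePreserving_piCongrLeft (fun _ : Fin 5 => ℝ)
    (finSumFinEquiv (m := 3) (n := 2))).symm
  have h2 := volume_measurePreserving_sumPiEquivProdPi (fun _ : Fin 3 ⊕ Fin 2 => ℝ)
  suffices h : splitCoords = MeasurableEquiv.sumPiEquivProdPi (fun _ : Fin 3 ⊕ Fin 2 => ℝ) ∘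
      (MeasurableEquiv.piCongrLeft (fun _ : Fin 5 => ℝ) (finSumFinEquiv (m := 3) (n := 2))).symm by
    rw [h]
    exact h2.comp h1
  funext x
  refine Prod.ext ?_ ?_ <;> funext i <;> fin_cases i <;> rfl

/-- The product of the reference elements as a subset of `ℝ⁵`. -/
def refSet : Set (Fin 5 → ℝ) := splitCoords ⁻¹' (refTetra ×ˢ refPanel)

theorem mem_refSet {x : Fin 5 → ℝ} : x ∈ refSet ↔
    (0 ≤ x 1 ∧ 0 ≤ x 2 ∧ x 1 + x 2 ≤ x 0 ∧ x 0 ≤ 1) ∧ 0 ≤ x 4 ∧ x 4 ≤ x 3 ∧ x 3 ≤ 1 :=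
  Iff.rfl

/-- A hyperplane is a proper subspace, hence null. This discards the common boundaries of cells and
the faces of the cube where a coordinate vanishes. -/
theorem ae_dotProduct_ne_zero {n : ℕ} {c : Fin n → ℝ} (hc : c ≠ 0) :
    ∀ᵐ x : Fin n → ℝ, c ⬝ᵥ x ≠ 0 := by
  have h := Measure.addHaar_submodule volume (LinearMap.ker (dotProductBilin ℝ ℝ c)) (by
    intro h
    refine hc (dotProduct_self_eq_zero.mp ?_)
    have : c ∈ LinearMap.ker (dotProductBilin ℝ ℝ c) := h ▸ Submodule.mem_top
    exact this)
  rw [ae_iff]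
  convert h using 2
  ext x
  simp [LinearMap.mem_ker]

/-- If almost every point of the product of the reference elements lies in exactly one cell, then
the integral is the sum of the integrals over the cells. -/
theorem lintegral_ref_eq_sum {ι : Type*} [Fintype ι] [DecidableEq ι] {P : ι → Set (Fin 5 → ℝ)}
    {Φ : ι → (Fin 5 → ℝ) → Fin 5 → ℝ} {J : ι → (Fin 5 → ℝ) → ℝ}
    (h : ∀ m, IsCubeParam (P m) (Φ m) (J m)) {A B : ι → Matrix (Fin 5) (Fin 5) ℤ}
    (hAB : ∀ m, A m * B m = 1)
    (hP : ∀ᵐ x : Fin 5 → ℝ, ∃ k, ∀ m,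
      ((B m).map (Int.cast : ℤ → ℝ)).mulVec x ∈ P m ↔ m = k ∧ x ∈ refSet)
    {f : (Fin 3 → ℝ) × (Fin 2 → ℝ) → ENNReal} (hf : Measurable f) :
    ∫⁻ q in refTetra ×ˢ refPanel, f q = ∑ m, ∫⁻ p in Icc (0 : Fin 5 → ℝ) 1,
      ENNReal.ofReal (J m p) * f (splitCoords (((A m).map (Int.cast : ℤ → ℝ)).mulVec (Φ m p))) := by
  have hs := measurePreserving_splitCoords
  have hmR : MeasurableSet (refTetra ×ˢ refPanel) :=
    measurableSet_refTetra.prod measurableSet_refPanel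
  have hfs := hf.comp hs.measurable
  have hSm : ∀ m, MeasurableSet {x | ((B m).map (Int.cast : ℤ → ℝ)).mulVec x ∈ P m} := fun m =>
    (measurePreserving_mulVec (hAB m)).measurable (h m).measurableSet
  calc ∫⁻ q in refTetra ×ˢ refPanel, f q = ∫⁻ x in refSet, f (splitCoords x) :=
        (hs.setLIntegral_comp_preimage hmR hf).symm
    _ = ∫⁻ x, ∑ m, {x | ((B m).map (Int.cast : ℤ → ℝ)).mulVec x ∈ P m}.indicator
          (f ∘ splitCoords) x := by
        rw [← lintegral_indicator (s := refSet) (hs.measurable hmR)]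
        refine lintegral_congr_ae ?_
        -- Off the null set the cells partition `refSet`, so its indicator is the sum of theirs with
        -- only the `k`-th term alive.
        filter_upwards [hP] with x ⟨k, hk⟩
        have hk' : ∀ m, x ∈ {x | ((B m).map (Int.cast : ℤ → ℝ)).mulVec x ∈ P m} ↔
          m = k ∧ x ∈ refSet := hk
        by_cases hx : x ∈ refSet
        · rw [indicator_of_mem hx, Finset.sum_eq_single k, indicator_of_mem ((hk' k).2 ⟨rfl, hx⟩)]
          · rfl
          · exact fun m _ hm => indicator_of_notMem (fun h => hm ((hk' m).1 h).1) _
          · simp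
        · rw [indicator_of_notMem hx, Finset.sum_eq_zero]
          exact fun m _ => indicator_of_notMem (fun h => hx ((hk' m).1 h).2) _
    _ = _ := by
        rw [lintegral_finsetSum _ fun m _ => hfs.indicator (hSm m)]
        refine Finset.sum_congr rfl fun m _ => ?_
        rw [lintegral_indicator (hSm m), (h m).lintegral_mulVec (hAB m) hfs]
        rfl

/-- Common vertex: from sorted to reference coordinates on each of the cells. -/
def vertexMat : Fin 2 → Matrix (Fin 5) (Fin 5) ℤ :=
  ![!![1, 0, 0, 0, 0; 0, 0, 1, 0, 0; 0, 1, -1, 0, 0; 0, 0, 0, 1, 0; 0, 0, 0, 0, 1],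
    !![0, 0, 1, 0, 0; 0, 0, 0, 0, 1; 0, 0, 0, 1, -1; 1, 0, 0, 0, 0; 0, 1, 0, 0, 0]]

/-- Common vertex: from reference to sorted coordinates on each of the cells. -/
def vertexMatInv : Fin 2 → Matrix (Fin 5) (Fin 5) ℤ :=
  ![!![1, 0, 0, 0, 0; 0, 1, 1, 0, 0; 0, 1, 0, 0, 0; 0, 0, 0, 1, 0; 0, 0, 0, 0, 1],
    !![0, 0, 0, 1, 0; 0, 0, 0, 0, 1; 1, 0, 0, 0, 0; 0, 1, 1, 0, 0; 0, 1, 0, 0, 0]]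

theorem vertexMat_mul (m : Fin 2) : vertexMat m * vertexMatInv m = 1 := by
  fin_cases m <;> decide

/-- Common edge: from sorted to reference coordinates on each of the cells. -/
def edgeMat : Fin 4 → Matrix (Fin 5) (Fin 5) ℤ :=
  ![!![1, 0, 0, 0, 0; 0, 0, 1, 0, 0; 0, 1, -1, 0, 0; 1, 0, 0, 0, -1; 0, 0, 0, 1, -1],
    !![1, 0, 0, 0, 0; 0, 0, 0, 0, 1; 0, 0, 0, 1, -1; 1, 0, -1, 0, 0; 0, 1, -1, 0, 0],
    !![1, 0, 0, 0, -1; 0, 0, 0, 1, -1; 0, 1, 0, -1, 0; 1, 0, 0, 0, 0; 0, 0, 1, 0, 0],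
    !![1, 0, 0, 0, -1; 0, 0, 0, 1, -1; 0, 0, 1, -1, 0; 1, 0, 0, 0, 0; 0, 1, 0, 0, 0]]

/-- Common edge: from reference to sorted coordinates on each of the cells. -/
def edgeMatInv : Fin 4 → Matrix (Fin 5) (Fin 5) ℤ :=
  ![!![1, 0, 0, 0, 0; 0, 1, 1, 0, 0; 0, 1, 0, 0, 0; 1, 0, 0, -1, 1; 1, 0, 0, -1, 0],
    !![1, 0, 0, 0, 0; 1, 0, 0, -1, 1; 1, 0, 0, -1, 0; 0, 1, 1, 0, 0; 0, 1, 0, 0, 0],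
    !![0, 0, 0, 1, 0; -1, 1, 1, 1, 0; 0, 0, 0, 0, 1; -1, 1, 0, 1, 0; -1, 0, 0, 1, 0],
    !![0, 0, 0, 1, 0; 0, 0, 0, 0, 1; -1, 1, 1, 1, 0; -1, 1, 0, 1, 0; -1, 0, 0, 1, 0]]

theorem edgeMat_mul (m : Fin 4) : edgeMat m * edgeMatInv m = 1 := by
  fin_cases m <;> decide

/-- Common face: from sorted to reference coordinates on each of the cells. -/
def faceMat : Fin 9 → Matrix (Fin 5) (Fin 5) ℤ :=
  ![!![1, 0, 0, 0, 0; 1, -1, 0, 1, 0; 0, 0, 1, -1, 0; 1, 0, 0, 0, -1; 1, -1, 0, 0, 0],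
    !![1, 0, 0, 0, 0; 1, -1, 0, 0, 1; 0, 0, 0, 1, -1; 1, 0, -1, 0, 0; 1, -1, 0, 0, 0],
    !![1, 0, 0, 0, 0; 1, -1, 0, 0, 1; 0, 0, 1, 0, -1; 1, 0, 0, -1, 0; 1, -1, 0, 0, 0],
    !![1, 0, 0, 0, 0; 1, -1, 0, 0, 0; 0, 0, 1, 0, 0; 1, 0, 0, 0, -1; 1, -1, 0, 1, -1],
    !![1, 0, 0, 0, -1; 1, -1, 0, 1, -1; 0, 0, 1, -1, 0; 1, 0, 0, 0, 0; 1, -1, 0, 0, 0],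
    !![1, 0, 0, -1, 0; 1, -1, 0, 0, 0; 0, 0, 1, -1, 0; 1, 0, 0, 0, 0; 1, -1, 0, 0, 1],
    !![1, 0, 0, 0, -1; 1, -1, 0, 0, 0; 0, 0, 0, 1, -1; 1, 0, 0, 0, 0; 1, -1, 1, 0, 0],
    !![1, 0, 0, 0, -1; 1, -1, 0, 0, 0; 0, 0, 1, 0, -1; 1, 0, 0, 0, 0; 1, -1, 0, 1, 0],
    !![1, 0, 0, 0, 0; 1, -1, 0, 0, 0; 0, 0, 0, 0, 1; 1, 0, 0, -1, 0; 1, -1, 1, -1, 0]]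

/-- Common face: from reference to sorted coordinates on each of the cells. -/
def faceMatInv : Fin 9 → Matrix (Fin 5) (Fin 5) ℤ :=
  ![!![1, 0, 0, 0, 0; 1, 0, 0, 0, -1; 0, 1, 1, 0, -1; 0, 1, 0, 0, -1; 1, 0, 0, -1, 0],
    !![1, 0, 0, 0, 0; 1, 0, 0, 0, -1; 1, 0, 0, -1, 0; 0, 1, 1, 0, -1; 0, 1, 0, 0, -1],
    !![1, 0, 0, 0, 0; 1, 0, 0, 0, -1; 0, 1, 1, 0, -1; 1, 0, 0, -1, 0; 0, 1, 0, 0, -1],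
    !![1, 0, 0, 0, 0; 1, -1, 0, 0, 0; 0, 0, 1, 0, 0; 1, -1, 0, -1, 1; 1, 0, 0, -1, 0],
    !![0, 0, 0, 1, 0; 0, 0, 0, 1, -1; -1, 1, 1, 1, -1; -1, 1, 0, 1, -1; -1, 0, 0, 1, 0],
    !![0, 0, 0, 1, 0; 0, -1, 0, 1, 0; -1, 0, 1, 1, 0; -1, 0, 0, 1, 0; 0, -1, 0, 0, 1],
    !![0, 0, 0, 1, 0; 0, -1, 0, 1, 0; 0, -1, 0, 0, 1; -1, 0, 1, 1, 0; -1, 0, 0, 1, 0],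
    !![0, 0, 0, 1, 0; 0, -1, 0, 1, 0; -1, 0, 1, 1, 0; 0, -1, 0, 0, 1; -1, 0, 0, 1, 0],
    !![1, 0, 0, 0, 0; 1, -1, 0, 0, 0; 1, -1, 0, -1, 1; 1, 0, 0, -1, 0; 0, 0, 1, 0, 0]]

theorem faceMat_mul (m : Fin 9) : faceMat m * faceMatInv m = 1 := by
  fin_cases m <;> decide

/-- The vertex `b` in both reference elements. -/
def refB : (Fin 3 → ℝ) × (Fin 2 → ℝ) := (![1, 0, 0], ![1, 0])

/-- The direction `c - b` in both reference elements. -/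
def refC : (Fin 3 → ℝ) × (Fin 2 → ℝ) := (![0, 1, 0], ![0, 1])

/-! ### The cell decompositions for a common vertex, edge and face. -/

/-- Common vertex: the cells in sorted coordinates. -/
def vertexCell : Fin 2 → Set (Fin 5 → ℝ) :=
  ![nested 0 1 0 3, nested 0 0 2 3]

/-- The cells are separated by the sign of `x 0 - x 3`: the larger of the two distances from the
shared vertex, in chart coordinates, is the radial variable. -/
theorem ae_exists_mem_vertexCell_iff : ∀ᵐ x : Fin 5 → ℝ, ∃ k, ∀ m,
    ((vertexMatInv m).map (Int.cast : ℤ → ℝ)).mulVec x ∈ vertexCell m ↔ m = k ∧ x ∈ refSet := by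
  filter_upwards [ae_dotProduct_ne_zero (c := ![1, 0, 0, -1, 0])
      (fun h => by simpa using congrFun h 0)] with x h1
  simp only [dotProduct, Fin.sum_univ_five, Matrix.cons_val] at h1
  refine h1.lt_or_gt.elim (fun h1 => ⟨1, ?_⟩) fun h1 => ⟨0, ?_⟩
  all_goals
    intro m
    fin_cases m <;>
    simp only [Fin.zero_eta, Fin.mk_one, vertexMatInv, vertexCell, mem_refSet,
      mem_nested, Matrix.mulVec, dotProduct, Fin.sum_univ_five, Matrix.cons_val,
      Matrix.map_apply, Matrix.of_apply, Int.cast_zero, Int.cast_one, zero_mul,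
      one_mul, add_zero, zero_add] <;>
    -- For `m ≠ k` the inequalities of the cell contradict the chosen strict sign. For `m = k`,
    -- given that sign, they are linearly equivalent to membership in `refSet`.
    first
    | refine iff_of_false (fun h => ?_) (fun h => absurd h.1 (by decide))
      linarith
    | refine ⟨fun h => ⟨by simp, ⟨?_, ?_, ?_, ?_⟩, ?_, ?_, ?_⟩, fun ⟨_, h⟩ =>
        ⟨?_, ?_, ?_, ?_, ?_, ?_, ?_, ?_, ?_, ?_⟩⟩ <;> linarith

theorem lintegral_ref_vertex {f : (Fin 3 → ℝ) × (Fin 2 → ℝ) → ENNReal} (hf : Measurable f) :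
    ∫⁻ q in refTetra ×ˢ refPanel, f q = ∑ m : Fin 2, ∫⁻ p in Icc (0 : Fin 5 → ℝ) 1,
      ENNReal.ofReal (p 0 ^ 4 * jacVertex (Fin.tail p) m) *
        f (p 0 • duffyVertex (Fin.tail p) m) := by
  have key := lintegral_ref_eq_sum (P := vertexCell) 
    (Φ := ![twoChainsMap, shortLongChainMap])
    (J := ![twoChainsJac, shortLongChainJac])
    (by
      intro m
      fin_cases m
      exacts [isCubeParam_twoChains, isCubeParam_shortLongChain])
    vertexMat_mul ae_exists_mem_vertexCell_iff hf
  rw [key]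
  refine Finset.sum_congr rfl fun m _ => lintegral_congr fun p => ?_
  congr 2
  · fin_cases m <;> simp [twoChainsJac, shortLongChainJac, jacVertex, Fin.tail] <;> ring
  · refine Prod.ext ?_ ?_ <;> funext i <;> fin_cases m <;> fin_cases i <;>
      simp [twoChainsMap, shortLongChainMap, splitCoords, vertexMat, Matrix.mulVec, dotProduct, Fin.sum_univ_five,
        Fin.tail,
        duffyVertex] <;> ring

/-- Common edge: the cells in sorted coordinates. -/
def edgeCell : Fin 4 → Set (Fin 5 → ℝ) :=
  ![nested 0 1 1 3, nested 0 1 1 3, nested 0 1 1 3,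
    nested 0 1 2 3]

/-- The two forms compare the barycentric weights of the shared vertices in the two elements: `1 - x
0` with `1 - x 3` for `a`, and `x 0 - x 1 - x 2` with `x 3 - x 4` for `b`. The four sign patterns
are the four cells. -/
theorem ae_exists_mem_edgeCell_iff : ∀ᵐ x : Fin 5 → ℝ, ∃ k, ∀ m,
    ((edgeMatInv m).map (Int.cast : ℤ → ℝ)).mulVec x ∈ edgeCell m ↔ m = k ∧ x ∈ refSet := by
  filter_upwards [ae_dotProduct_ne_zero (c := ![1, 0, 0, -1, 0])
      (fun h => by simpa using congrFun h 0),
    ae_dotProduct_ne_zero (c := ![1, -1, -1, -1, 1])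
      (fun h => by simpa using congrFun h 0)] with x h1 h2
  simp only [dotProduct, Fin.sum_univ_five, Matrix.cons_val] at h1 h2
  refine h1.lt_or_gt.elim
    (fun h1 => h2.lt_or_gt.elim (fun h2 => ⟨2, ?_⟩) fun h2 => ⟨3, ?_⟩)
    (fun h1 => h2.lt_or_gt.elim (fun h2 => ⟨0, ?_⟩) fun h2 => ⟨1, ?_⟩)
  all_goals
    intro m
    fin_cases m <;>
    simp only [Fin.zero_eta, Fin.mk_one, Fin.reduceFinMk, edgeMatInv, edgeCell, mem_refSet,
      mem_nested, Matrix.mulVec, dotProduct, Fin.sum_univ_five, Matrix.cons_val,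
      Matrix.map_apply, Matrix.of_apply, Int.cast_zero, Int.cast_one, Int.cast_neg, zero_mul,
      one_mul, neg_mul, add_zero, zero_add] <;>
    first
    | refine iff_of_false (fun h => ?_) (fun h => absurd h.1 (by decide))
      linarith
    | refine ⟨fun h => ⟨by simp, ⟨?_, ?_, ?_, ?_⟩, ?_, ?_, ?_⟩, fun ⟨_, h⟩ =>
        ⟨?_, ?_, ?_, ?_, ?_, ?_, ?_, ?_, ?_, ?_⟩⟩ <;> linarith

theorem lintegral_ref_edge {f : (Fin 3 → ℝ) × (Fin 2 → ℝ) → ENNReal} (hf : Measurable f) :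
    ∫⁻ q in refTetra ×ˢ refPanel, f q = ∑ m : Fin 4, ∫⁻ p in Icc (0 : Fin 5 → ℝ) 1,
      ENNReal.ofReal (p 0 ^ 4 * (p 1 ^ 3 * jacEdge (Fin.tail (Fin.tail p)) m)) *
        f (p 0 • refB + (p 0 * p 1) • duffyEdge (Fin.tail (Fin.tail p)) m) := by
  have key := lintegral_ref_eq_sum (P := edgeCell) 
    (Φ := ![lateBranchMap, lateBranchMap, lateBranchMap, chainMap])
    (J := ![lateBranchJac, lateBranchJac, lateBranchJac, chainJac])
    (by
      intro m
      fin_cases m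
      exacts [isCubeParam_lateBranch, isCubeParam_lateBranch, isCubeParam_lateBranch,
        isCubeParam_chain])
    edgeMat_mul ae_exists_mem_edgeCell_iff hf
  rw [key]
  refine Finset.sum_congr rfl fun m _ => lintegral_congr fun p => ?_
  congr 2
  · fin_cases m <;> simp [lateBranchJac, chainJac, jacEdge, Fin.tail] <;> ring
  · refine Prod.ext ?_ ?_ <;> funext i <;> fin_cases m <;> fin_cases i <;>
      simp [lateBranchMap, chainMap, splitCoords, edgeMat, Matrix.mulVec, dotProduct, Fin.sum_univ_five,
        Fin.tail,
        duffyEdge, refB] <;> ring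

/-- Common face: the cells in sorted coordinates. -/
def faceCell : Fin 9 → Set (Fin 5 → ℝ) :=
  ![nested 0 1 2 3, nested 0 1 2 3, nested 0 1 2 3, nested 0 1 2 3, nested 0 1 2 3,
    nested 0 1 2 3, nested 0 1 2 3, nested 0 1 2 3, nested 0 1 2 2]

/-- Besides the weights of `a`, `b` and `c` (forms `h1`, `h4`, `h2`), `h3` compares the joint weight
of `b` and `d` in the tetrahedron with that of `b` in the panel. On the reference set the forms are
related: for instance `x 2 ≥ 0` rules out `h3 < 0 < h4`. Nine cells remain, and in each branch only
the signs not already forced are split. -/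
theorem ae_exists_mem_faceCell_iff : ∀ᵐ x : Fin 5 → ℝ, ∃ k, ∀ m,
    ((faceMatInv m).map (Int.cast : ℤ → ℝ)).mulVec x ∈ faceCell m ↔ m = k ∧ x ∈ refSet := by
  filter_upwards [ae_dotProduct_ne_zero (c := ![1, 0, 0, -1, 0])
      (fun h => by simpa using congrFun h 0),
    ae_dotProduct_ne_zero (c := ![0, 1, 0, 0, -1])
      (fun h => by simpa using congrFun h 1),
    ae_dotProduct_ne_zero (c := ![1, -1, 0, -1, 1])
      (fun h => by simpa using congrFun h 0),
    ae_dotProduct_ne_zero (c := ![1, -1, -1, -1, 1])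
      (fun h => by simpa using congrFun h 0)] with x h1 h2 h3 h4
  simp only [dotProduct, Fin.sum_univ_five, Matrix.cons_val] at h1 h2 h3 h4
  refine h1.lt_or_gt.elim
    (fun h1 => h2.lt_or_gt.elim
      (fun h2 => h3.lt_or_gt.elim (fun h3 => ⟨5, ?_⟩)
        fun h3 => h4.lt_or_gt.elim (fun h4 => ⟨7, ?_⟩) fun h4 => ⟨6, ?_⟩)
      fun h2 => ⟨4, ?_⟩)
    (fun h1 => h2.lt_or_gt.elim
      (fun h2 => h4.lt_or_gt.elim (fun h4 => ⟨3, ?_⟩) fun h4 => ⟨8, ?_⟩)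
      fun h2 => h3.lt_or_gt.elim (fun h3 => ⟨0, ?_⟩)
        fun h3 => h4.lt_or_gt.elim (fun h4 => ⟨2, ?_⟩) fun h4 => ⟨1, ?_⟩)
  all_goals
    intro m
    fin_cases m <;>
    simp only [Fin.zero_eta, Fin.mk_one, Fin.reduceFinMk, faceMatInv, faceCell, mem_refSet,
      mem_nested, Matrix.mulVec, dotProduct, Fin.sum_univ_five, Matrix.cons_val,
      Matrix.map_apply, Matrix.of_apply, Int.cast_zero, Int.cast_one, Int.cast_neg, zero_mul,
      one_mul, neg_mul, add_zero, zero_add] <;>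
    first
    | refine iff_of_false (fun h => ?_) (fun h => absurd h.1 (by decide))
      linarith
    | refine ⟨fun h => ⟨by simp, ⟨?_, ?_, ?_, ?_⟩, ?_, ?_, ?_⟩, fun ⟨_, h⟩ =>
        ⟨?_, ?_, ?_, ?_, ?_, ?_, ?_, ?_, ?_, ?_⟩⟩ <;> linarith

theorem lintegral_ref_face {f : (Fin 3 → ℝ) × (Fin 2 → ℝ) → ENNReal} (hf : Measurable f) :
    ∫⁻ q in refTetra ×ˢ refPanel, f q = ∑ m : Fin 9, ∫⁻ p in Icc (0 : Fin 5 → ℝ) 1,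
      ENNReal.ofReal (p 0 ^ 4 * (p 1 ^ 3 * (p 2 ^ 2 * jacFace (Fin.tail (Fin.tail (Fin.tail p))) m))) *
        f (p 0 • refB + (p 0 * (1 - p 1)) • refC +
          (p 0 * p 1 * p 2) • duffyFace (Fin.tail (Fin.tail (Fin.tail p))) m) := by
  have key := lintegral_ref_eq_sum (P := faceCell) 
    (Φ := ![chainMap, chainMap, chainMap, chainMap, chainMap, chainMap, chainMap, chainMap, forkMap])
    (J := ![chainJac, chainJac, chainJac, chainJac, chainJac, chainJac, chainJac, chainJac, forkJac])
    (by
      intro m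
      fin_cases m
      exacts [isCubeParam_chain, isCubeParam_chain, isCubeParam_chain, isCubeParam_chain,
        isCubeParam_chain, isCubeParam_chain, isCubeParam_chain, isCubeParam_chain,
        isCubeParam_fork])
    faceMat_mul ae_exists_mem_faceCell_iff hf
  rw [key]
  refine Finset.sum_congr rfl fun m _ => lintegral_congr fun p => ?_
  congr 2
  · fin_cases m <;> simp [chainJac, forkJac, jacFace, Fin.tail] <;> ring
  · refine Prod.ext ?_ ?_ <;> funext i <;> fin_cases m <;> fin_cases i <;>
      simp [chainMap, forkMap, splitCoords, faceMat, Matrix.mulVec, dotProduct, Fin.sum_univ_five,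
        Fin.tail,
        duffyFace, refB, refC] <;> ring

/-! ### From nonnegative integrals to integrals of homogeneous functions. -/

/-- The identity for all nonnegative `f` says that `μ` is a finite sum of push-forwards of weighted
copies of `ν`. Integrability and integrals of signed functions then transfer at once, without any
injectivity of the maps `G m`. -/
theorem integrable_and_integral_of_lintegral_eq_sum {X Y ι : Type*} [MeasurableSpace X]
    [MeasurableSpace Y] [Fintype ι] {μ : Measure X} {ν : Measure Y} {G : ι → Y → X}
    {J : ι → Y → ℝ} (hG : ∀ m, Measurable (G m)) (hJ : ∀ m, Measurable (J m))
    (hJ0 : ∀ m, ∀ᵐ p ∂ν, 0 ≤ J m p)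
    (h : ∀ f : X → ENNReal, Measurable f →
      ∫⁻ x, f x ∂μ = ∑ m, ∫⁻ p, ENNReal.ofReal (J m p) * f (G m p) ∂ν)
    {F : X → ℝ} (hF : Measurable F) (hint : ∀ m, Integrable (fun p => J m p * F (G m p)) ν) :
    Integrable F μ ∧ ∫ x, F x ∂μ = ∑ m, ∫ p, J m p * F (G m p) ∂ν := by
  have hμ : μ = ∑ m, Measure.map (G m) (ν.withDensity fun p => ENNReal.ofReal (J m p)) := by
    refine Measure.ext_of_lintegral _ fun f hf => ?_
    rw [h f hf, lintegral_finsetSum_measure]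
    refine Finset.sum_congr rfl fun m _ => ?_
    rw [lintegral_map hf (hG m)]
    exact (lintegral_withDensity_eq_lintegral_mul _ (hJ m).ennreal_ofReal (hf.comp (hG m))).symm
  have hm : ∀ m, Integrable F (Measure.map (G m) (ν.withDensity fun p =>
      ENNReal.ofReal (J m p))) := by
    intro m
    rw [integrable_map_measure hF.aestronglyMeasurable (hG m).aemeasurable,
      integrable_withDensity_iff_integrable_smul' (hJ m).ennreal_ofReal (by simp)]
    refine (hint m).congr ?_
    filter_upwards [hJ0 m] with p hp
    simp [ENNReal.toReal_ofReal hp]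
  rw [hμ]
  refine ⟨integrable_finsetSum_measure.mpr fun m _ => hm m, ?_⟩
  rw [integral_finsetSum_measure fun m _ => hm m]
  refine Finset.sum_congr rfl fun m _ => ?_
  rw [integral_map (hG m).aemeasurable hF.aestronglyMeasurable,
    integral_withDensity_eq_integral_toReal_smul (hJ m).ennreal_ofReal (by simp)]
  refine integral_congr_ae ?_
  filter_upwards [hJ0 m] with p hp
  simp [ENNReal.toReal_ofReal hp]

theorem continuous_duffyVertex (m : Fin 2) : Continuous fun η => duffyVertex η m := by
  fin_cases m <;> refine (continuous_pi fun i => ?_).prodMk (continuous_pi fun i => ?_) <;>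
    fin_cases i <;> simp <;> fun_prop

theorem continuous_duffyEdge (m : Fin 4) : Continuous fun η => duffyEdge η m := by
  fin_cases m <;> refine (continuous_pi fun i => ?_).prodMk (continuous_pi fun i => ?_) <;>
    fin_cases i <;> simp <;> fun_prop

theorem continuous_duffyFace (m : Fin 9) : Continuous fun η => duffyFace η m := by
  fin_cases m <;> refine (continuous_pi fun i => ?_).prodMk (continuous_pi fun i => ?_) <;>
    fin_cases i <;> simp <;> fun_prop

theorem continuous_jacVertex (m : Fin 2) : Continuous fun η => jacVertex η m := by
  fin_cases m <;> simp [jacVertex] <;> fun_prop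

theorem continuous_jacEdge (m : Fin 4) : Continuous fun η => jacEdge η m := by
  fin_cases m <;> simp [jacEdge] <;> fun_prop

theorem continuous_jacFace (m : Fin 9) : Continuous fun η => jacFace η m := by
  fin_cases m <;> simp [jacFace] <;> fun_prop

theorem jacVertex_nonneg {η : Fin 4 → ℝ} (h : 0 ≤ η) (m : Fin 2) : 0 ≤ jacVertex η m := by
  have h0 := h 0
  have h1 := h 1
  have h2 := h 2
  simp only [Pi.zero_apply] at h0 h1 h2
  fin_cases m <;> simp [jacVertex] <;> positivity

theorem jacEdge_nonneg {η : Fin 3 → ℝ} (h : 0 ≤ η) (m : Fin 4) : 0 ≤ jacEdge η m := by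
  have h0 := h 0
  have h1 := h 1
  simp only [Pi.zero_apply] at h0 h1
  fin_cases m <;> simp [jacEdge] <;> positivity

theorem jacFace_nonneg {η : Fin 2 → ℝ} (h : 0 ≤ η) (m : Fin 9) : 0 ≤ jacFace η m := by
  have h0 := h 0
  simp only [Pi.zero_apply] at h0
  fin_cases m <;> simp [jacFace] <;> positivity

theorem measurable_tail {n : ℕ} :
    Measurable fun q : Fin (n + 1) → ℝ => (Fin.tail q : Fin n → ℝ) :=
  measurable_pi_lambda _ fun i => measurable_pi_apply i.succ

theorem ae_Icc_pos {n : ℕ} :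
    ∀ᵐ p ∂(volume.restrict (Icc (0 : Fin n → ℝ) 1)), ∀ i, 0 < p i := by
  have h : ∀ᵐ p : Fin n → ℝ, ∀ i, p i ≠ 0 := by
    rw [ae_all_iff]
    intro i
    filter_upwards [ae_dotProduct_ne_zero (c := Pi.single i 1) (by simp)] with p hp
    simpa using hp
  filter_upwards [ae_restrict_of_ae h, ae_restrict_mem measurableSet_Icc] with p hp hp'
  exact fun i => lt_of_le_of_ne (hp'.1 i) (hp i).symm

theorem integral_ref_vertex {s : ℝ} (hs : s < 1) {F : (Fin 3 → ℝ) × (Fin 2 → ℝ) → ℝ}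
    (hF : Measurable F) (hom : ∀ r : ℝ, 0 < r → ∀ q, F (r • q) = r ^ (-2 * s) * F q)
    (hcont : ∀ m, ContinuousOn (fun η => F (duffyVertex η m)) (Icc 0 1)) :
    IntegrableOn F (refTetra ×ˢ refPanel) ∧
      ContinuousOn (fun η => ∑ m, F (duffyVertex η m) * jacVertex η m) (Icc 0 1) ∧
      ∫ q in refTetra ×ˢ refPanel, F q = 1 / (5 - 2 * s) *
        ∫ η in Icc (0 : Fin 4 → ℝ) 1, ∑ m, F (duffyVertex η m) * jacVertex η m := by
  have hc : ∀ m, ContinuousOn (fun η => F (duffyVertex η m) * jacVertex η m) (Icc 0 1) :=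
    fun m => (hcont m).mul (continuous_jacVertex m).continuousOn
  have hi : ∀ m, IntegrableOn (fun η => F (duffyVertex η m) * jacVertex η m) (Icc 0 1) :=
    fun m => (hc m).integrableOn_compact isCompact_Icc
  have h1 := fun m => rpow_mul_tail (hi m) (e := 4 - 2 * s) (by linarith)
  have heq : ∀ m, (fun p : Fin 5 → ℝ => p 0 ^ (4 - 2 * s) *
        (F (duffyVertex (Fin.tail p) m) * jacVertex (Fin.tail p) m))
      =ᵐ[volume.restrict (Icc 0 1)] fun p => p 0 ^ 4 * jacVertex (Fin.tail p) m *
        F (p 0 • duffyVertex (Fin.tail p) m) := by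
    intro m
    filter_upwards [ae_Icc_pos] with p hp
    -- The Jacobian contributes `4` and homogeneity `-2 * s`. Homogeneity needs a positive radius,
    -- so the identity is only claimed almost everywhere.
    rw [hom _ (hp 0), show (4 : ℝ) - 2 * s = (4 : ℕ) + -2 * s by push_cast; ring,
      Real.rpow_add (hp 0), Real.rpow_natCast]
    ring
  have ht := measurable_tail (n := 4)
  obtain ⟨hint, heqn⟩ := integrable_and_integral_of_lintegral_eq_sum
    (μ := volume.restrict (refTetra ×ˢ refPanel)) (ν := volume.restrict (Icc (0 : Fin 5 → ℝ) 1))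
    (G := fun (m : Fin 2) p => p 0 • duffyVertex (Fin.tail p) m)
    (J := fun m p => p 0 ^ 4 * jacVertex (Fin.tail p) m)
    (fun m => (measurable_pi_apply 0).smul ((continuous_duffyVertex m).measurable.comp ht))
    (fun m => ((measurable_pi_apply 0).pow_const 4).mul
      ((continuous_jacVertex m).measurable.comp ht))
    (fun m => by
      filter_upwards [ae_Icc_pos] with p hp
      exact mul_nonneg (pow_nonneg (hp 0).le _) (jacVertex_nonneg (fun i => (hp i.succ).le) m))
    (fun f hf => lintegral_ref_vertex hf) hF (fun m => (h1 m).1.congr (heq m))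
  refine ⟨hint, continuousOn_finsetSum _ fun m _ => hc m, heqn.trans ?_⟩
  rw [integral_finsetSum _ fun m _ => hi m, Finset.mul_sum]
  refine Finset.sum_congr rfl fun m _ => ?_
  rw [← integral_congr_ae (heq m), (h1 m).2]
  ring_nf

theorem integral_ref_edge {s : ℝ} (hs : s < 1) {F : (Fin 3 → ℝ) × (Fin 2 → ℝ) → ℝ}
    (hF : Measurable F)
    (hom : ∀ a r : ℝ, 0 < r → ∀ q, F (a • refB + r • q) = r ^ (-2 * s) * F q)
    (hcont : ∀ m, ContinuousOn (fun η => F (duffyEdge η m)) (Icc 0 1)) :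
    IntegrableOn F (refTetra ×ˢ refPanel) ∧
      ContinuousOn (fun η => ∑ m, F (duffyEdge η m) * jacEdge η m) (Icc 0 1) ∧
      ∫ q in refTetra ×ˢ refPanel, F q = 1 / (5 - 2 * s) * (1 / (4 - 2 * s)) *
        ∫ η in Icc (0 : Fin 3 → ℝ) 1, ∑ m, F (duffyEdge η m) * jacEdge η m := by
  have hc : ∀ m, ContinuousOn (fun η => F (duffyEdge η m) * jacEdge η m) (Icc 0 1) :=
    fun m => (hcont m).mul (continuous_jacEdge m).continuousOn
  have hi : ∀ m, IntegrableOn (fun η => F (duffyEdge η m) * jacEdge η m) (Icc 0 1) :=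
    fun m => (hc m).integrableOn_compact isCompact_Icc
  have h1 := fun m => rpow_mul_tail (hi m) (e := 3 - 2 * s) (by linarith)
  have h2 := fun m => rpow_mul_tail (h1 m).1 (e := 4 - 2 * s) (by linarith)
  have heq : ∀ m, (fun p : Fin 5 → ℝ => p 0 ^ (4 - 2 * s) * (Fin.tail p 0 ^ (3 - 2 * s) *
        (F (duffyEdge (Fin.tail (Fin.tail p)) m) * jacEdge (Fin.tail (Fin.tail p)) m)))
      =ᵐ[volume.restrict (Icc 0 1)] fun p => p 0 ^ 4 * (p 1 ^ 3 *
        jacEdge (Fin.tail (Fin.tail p)) m) *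
        F (p 0 • refB + (p 0 * p 1) • duffyEdge (Fin.tail (Fin.tail p)) m) := by
    intro m
    filter_upwards [ae_Icc_pos] with p hp
    have ht : Fin.tail p 0 = p 1 := rfl
    rw [hom _ _ (mul_pos (hp 0) (hp 1)), ht, Real.mul_rpow (hp 0).le (hp 1).le,
      show (4 : ℝ) - 2 * s = (4 : ℕ) + -2 * s by push_cast; ring,
      show (3 : ℝ) - 2 * s = (3 : ℕ) + -2 * s by push_cast; ring,
      Real.rpow_add (hp 0), Real.rpow_natCast, Real.rpow_add (hp 1), Real.rpow_natCast]
    ring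
  have ht : Measurable fun p : Fin 5 → ℝ => (Fin.tail (Fin.tail p) : Fin 3 → ℝ) :=
    measurable_tail.comp measurable_tail
  obtain ⟨hint, heqn⟩ := integrable_and_integral_of_lintegral_eq_sum
    (μ := volume.restrict (refTetra ×ˢ refPanel)) (ν := volume.restrict (Icc (0 : Fin 5 → ℝ) 1))
    (G := fun (m : Fin 4) p => p 0 • refB + (p 0 * p 1) • duffyEdge (Fin.tail (Fin.tail p)) m)
    (J := fun m p => p 0 ^ 4 * (p 1 ^ 3 * jacEdge (Fin.tail (Fin.tail p)) m))
    (fun m => ((measurable_pi_apply 0).smul_const _).add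
      (((measurable_pi_apply 0).mul (measurable_pi_apply 1)).smul
        ((continuous_duffyEdge m).measurable.comp ht)))
    (fun m => ((measurable_pi_apply 0).pow_const 4).mul
      (((measurable_pi_apply 1).pow_const 3).mul ((continuous_jacEdge m).measurable.comp ht)))
    (fun m => by
      filter_upwards [ae_Icc_pos] with p hp
      exact mul_nonneg (pow_nonneg (hp 0).le _) (mul_nonneg (pow_nonneg (hp 1).le _)
        (jacEdge_nonneg (fun i => (hp i.succ.succ).le) m)))
    (fun f hf => lintegral_ref_edge hf) hF (fun m => (h2 m).1.congr (heq m))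
  refine ⟨hint, continuousOn_finsetSum _ fun m _ => hc m, heqn.trans ?_⟩
  rw [integral_finsetSum _ fun m _ => hi m, Finset.mul_sum]
  refine Finset.sum_congr rfl fun m _ => ?_
  rw [← integral_congr_ae (heq m), (h2 m).2, (h1 m).2]
  ring_nf

theorem integral_ref_face {s : ℝ} (hs : s < 1) {F : (Fin 3 → ℝ) × (Fin 2 → ℝ) → ℝ}
    (hF : Measurable F)
    (hom : ∀ a b r : ℝ, 0 < r → ∀ q, F (a • refB + b • refC + r • q) = r ^ (-2 * s) * F q)
    (hcont : ∀ m, ContinuousOn (fun η => F (duffyFace η m)) (Icc 0 1)) :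
    IntegrableOn F (refTetra ×ˢ refPanel) ∧
      ContinuousOn (fun η => ∑ m, F (duffyFace η m) * jacFace η m) (Icc 0 1) ∧
      ∫ q in refTetra ×ˢ refPanel, F q =
        1 / (5 - 2 * s) * (1 / (4 - 2 * s)) * (1 / (3 - 2 * s)) *
        ∫ η in Icc (0 : Fin 2 → ℝ) 1, ∑ m, F (duffyFace η m) * jacFace η m := by
  have hc : ∀ m, ContinuousOn (fun η => F (duffyFace η m) * jacFace η m) (Icc 0 1) :=
    fun m => (hcont m).mul (continuous_jacFace m).continuousOn
  have hi : ∀ m, IntegrableOn (fun η => F (duffyFace η m) * jacFace η m) (Icc 0 1) :=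
    fun m => (hc m).integrableOn_compact isCompact_Icc
  -- The radial variables are adjoined from the innermost `ξ₃` outwards to `ξ₁`.
  have h1 := fun m => rpow_mul_tail (hi m) (e := 2 - 2 * s) (by linarith)
  have h2 := fun m => rpow_mul_tail (h1 m).1 (e := 3 - 2 * s) (by linarith)
  have h3 := fun m => rpow_mul_tail (h2 m).1 (e := 4 - 2 * s) (by linarith)
  have heq : ∀ m, (fun p : Fin 5 → ℝ => p 0 ^ (4 - 2 * s) * (Fin.tail p 0 ^ (3 - 2 * s) *
        (Fin.tail (Fin.tail p) 0 ^ (2 - 2 * s) *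
        (F (duffyFace (Fin.tail (Fin.tail (Fin.tail p))) m) *
          jacFace (Fin.tail (Fin.tail (Fin.tail p))) m))))
      =ᵐ[volume.restrict (Icc 0 1)] fun p => p 0 ^ 4 * (p 1 ^ 3 * (p 2 ^ 2 *
        jacFace (Fin.tail (Fin.tail (Fin.tail p))) m)) *
        F (p 0 • refB + (p 0 * (1 - p 1)) • refC +
          (p 0 * p 1 * p 2) • duffyFace (Fin.tail (Fin.tail (Fin.tail p))) m) := by
    intro m
    filter_upwards [ae_Icc_pos] with p hp
    have ht : Fin.tail p 0 = p 1 := rfl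
    have ht' : Fin.tail (Fin.tail p) 0 = p 2 := rfl
    rw [hom _ _ _ (mul_pos (mul_pos (hp 0) (hp 1)) (hp 2)), ht, ht',
      Real.mul_rpow (mul_pos (hp 0) (hp 1)).le (hp 2).le, Real.mul_rpow (hp 0).le (hp 1).le,
      show (4 : ℝ) - 2 * s = (4 : ℕ) + -2 * s by push_cast; ring,
      show (3 : ℝ) - 2 * s = (3 : ℕ) + -2 * s by push_cast; ring,
      show (2 : ℝ) - 2 * s = (2 : ℕ) + -2 * s by push_cast; ring,
      Real.rpow_add (hp 0), Real.rpow_natCast, Real.rpow_add (hp 1), Real.rpow_natCast,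
      Real.rpow_add (hp 2), Real.rpow_natCast]
    ring
  have ht : Measurable fun p : Fin 5 → ℝ => (Fin.tail (Fin.tail (Fin.tail p)) : Fin 2 → ℝ) :=
    measurable_tail.comp (measurable_tail.comp measurable_tail)
  obtain ⟨hint, heqn⟩ := integrable_and_integral_of_lintegral_eq_sum
    (μ := volume.restrict (refTetra ×ˢ refPanel)) (ν := volume.restrict (Icc (0 : Fin 5 → ℝ) 1))
    (G := fun (m : Fin 9) p => p 0 • refB + (p 0 * (1 - p 1)) • refC +
      (p 0 * p 1 * p 2) • duffyFace (Fin.tail (Fin.tail (Fin.tail p))) m)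
    (J := fun m p => p 0 ^ 4 * (p 1 ^ 3 * (p 2 ^ 2 *
      jacFace (Fin.tail (Fin.tail (Fin.tail p))) m)))
    (fun m => (((measurable_pi_apply 0).smul_const _).add
      (((measurable_pi_apply 0).mul (measurable_const.sub (measurable_pi_apply 1))).smul_const
        _)).add ((((measurable_pi_apply 0).mul (measurable_pi_apply 1)).mul
          (measurable_pi_apply 2)).smul ((continuous_duffyFace m).measurable.comp ht)))
    (fun m => ((measurable_pi_apply 0).pow_const 4).mul
      (((measurable_pi_apply 1).pow_const 3).mul (((measurable_pi_apply 2).pow_const 2).mul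
        ((continuous_jacFace m).measurable.comp ht))))
    (fun m => by
      filter_upwards [ae_Icc_pos] with p hp
      exact mul_nonneg (pow_nonneg (hp 0).le _) (mul_nonneg (pow_nonneg (hp 1).le _)
        (mul_nonneg (pow_nonneg (hp 2).le _)
          (jacFace_nonneg (fun i => (hp i.succ.succ.succ).le) m))))
    (fun f hf => lintegral_ref_face hf) hF (fun m => (h3 m).1.congr (heq m))
  refine ⟨hint, continuousOn_finsetSum _ fun m _ => hc m, heqn.trans ?_⟩
  rw [integral_finsetSum _ fun m _ => hi m, Finset.mul_sum]
  refine Finset.sum_congr rfl fun m _ => ?_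
  rw [← integral_congr_ae (heq m), (h3 m).2, (h2 m).2, (h1 m).2]
  ring_nf

/-! ### Affine charts and their effect on measures. -/

theorem tetraChart_eq (t : Fin 4 → E3) (x : Fin 3 → ℝ) : tetraChart t x =
    x 0 • (t 1 - t 0) + x 1 • (t 2 - t 1) + x 2 • (t 3 - t 1) + t 0 := by
  ext i
  simp [tetraChart, tetraMat, Matrix.mulVec, dotProduct, Fin.sum_univ_three]
  ring

theorem panelChart_eq (τ : Fin 3 → E3) (y : Fin 2 → ℝ) : panelChart τ y =
    y 0 • (τ 1 - τ 0) + y 1 • (τ 2 - τ 1) + τ 0 := by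
  ext i
  simp [panelChart, panelMat, Matrix.mulVec, dotProduct, Fin.sum_univ_two]
  ring

theorem continuous_tetraChart (t : Fin 4 → E3) : Continuous (tetraChart t) := by
  simp only [funext (tetraChart_eq t)]
  fun_prop

theorem continuous_panelChart (τ : Fin 3 → E3) : Continuous (panelChart τ) := by
  simp only [funext (panelChart_eq τ)]
  fun_prop

theorem tetra_lin_indep {t : Fin 4 → E3} (ht : AffineIndependent ℝ t) {a b c : ℝ}
    (h : a • (t 1 - t 0) + b • (t 2 - t 1) + c • (t 3 - t 1) = 0) : a = 0 ∧ b = 0 ∧ c = 0 := by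
  rw [affineIndependent_iff] at ht
  -- These are the coefficients of the vertices after expanding `h`; their sum is zero, as affine
  -- independence requires.
  have := ht Finset.univ ![-a, a - b - c, b, c] (by
    simp [Fin.sum_univ_four]
    ring) (by
    simp only [Fin.sum_univ_four, Matrix.cons_val]
    rw [← h]
    module)
  have h0 := this 0 (Finset.mem_univ _)
  have h2 := this 2 (Finset.mem_univ _)
  have h3 := this 3 (Finset.mem_univ _)
  simp at h0 h2 h3
  exact ⟨h0, h2, h3⟩

theorem panel_lin_indep {τ : Fin 3 → E3} (hτ : AffineIndependent ℝ τ) {a b : ℝ}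
    (h : a • (τ 1 - τ 0) + b • (τ 2 - τ 1) = 0) : a = 0 ∧ b = 0 := by
  rw [affineIndependent_iff] at hτ
  have := hτ Finset.univ ![-a, a - b, b] (by
    simp [Fin.sum_univ_three]
    ring) (by
    simp only [Fin.sum_univ_three, Matrix.cons_val]
    rw [← h]
    module)
  have h0 := this 0 (Finset.mem_univ _)
  have h2 := this 2 (Finset.mem_univ _)
  simp at h0 h2
  exact ⟨h0, h2⟩

theorem tetraChart_injective {t : Fin 4 → E3} (ht : AffineIndependent ℝ t) :
    Function.Injective (tetraChart t) := by
  intro x y h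
  obtain ⟨h0, h1, h2⟩ := tetra_lin_indep ht (a := x 0 - y 0) (b := x 1 - y 1) (c := x 2 - y 2) (by
    rw [tetraChart_eq, tetraChart_eq] at h
    rw [← sub_eq_zero] at h
    rw [← h]
    module)
  ext i
  fin_cases i <;> simp <;> linarith

theorem panelChart_injective {τ : Fin 3 → E3} (hτ : AffineIndependent ℝ τ) :
    Function.Injective (panelChart τ) := by
  intro x y h
  obtain ⟨h0, h1⟩ := panel_lin_indep hτ (a := x 0 - y 0) (b := x 1 - y 1) (by
    rw [panelChart_eq, panelChart_eq] at h
    rw [← sub_eq_zero] at h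
    rw [← h]
    module)
  ext i
  fin_cases i <;> simp <;> linarith

theorem tetraChart_image (t : Fin 4 → E3) : tetraChart t '' refTetra = tetra t := by
  refine Subset.antisymm ?_ (convexHull_min ?_ ?_)
  · rintro _ ⟨x, ⟨h1, h2, h3, h4⟩, rfl⟩
    -- Barycentric coordinates of the point with chart coordinates `x`.
    refine mem_convexHull_of_exists_fintype ![1 - x 0, x 0 - x 1 - x 2, x 1, x 2] t ?_ ?_
      (fun i => mem_range_self i) ?_
    · intro i
      fin_cases i <;> simp <;> linarith
    · simp [Fin.sum_univ_four]
      ring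
    · simp only [Fin.sum_univ_four, Matrix.cons_val, tetraChart_eq]
      module
  · rintro _ ⟨i, rfl⟩
    fin_cases i
    · exact ⟨![0, 0, 0], by simp [refTetra], by simp [tetraChart_eq]⟩
    · exact ⟨![1, 0, 0], by simp [refTetra], by simp [tetraChart_eq]⟩
    · exact ⟨![1, 1, 0], by simp [refTetra], by simp [tetraChart_eq]⟩
    · exact ⟨![1, 0, 1], by simp [refTetra], by simp [tetraChart_eq]⟩
  · rintro _ ⟨x, ⟨h1, h2, h3, h4⟩, rfl⟩ _ ⟨y, ⟨k1, k2, k3, k4⟩, rfl⟩ a b ha hb hab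
    refine ⟨a • x + b • y, ⟨?_, ?_, ?_, ?_⟩, ?_⟩
    · simp only [Pi.add_apply, Pi.smul_apply, smul_eq_mul]
      positivity
    · simp only [Pi.add_apply, Pi.smul_apply, smul_eq_mul]
      positivity
    · simp only [Pi.add_apply, Pi.smul_apply, smul_eq_mul]
      nlinarith
    · simp only [Pi.add_apply, Pi.smul_apply, smul_eq_mul]
      nlinarith
    · obtain rfl : b = 1 - a := by linarith
      simp only [tetraChart_eq, Pi.add_apply, Pi.smul_apply, smul_eq_mul]
      module

theorem panelChart_image (τ : Fin 3 → E3) : panelChart τ '' refPanel = panel τ := by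
  refine Subset.antisymm ?_ (convexHull_min ?_ ?_)
  · rintro _ ⟨y, ⟨h1, h2, h3⟩, rfl⟩
    refine mem_convexHull_of_exists_fintype ![1 - y 0, y 0 - y 1, y 1] τ ?_ ?_
      (fun i => mem_range_self i) ?_
    · intro i
      fin_cases i <;> simp <;> linarith
    · simp [Fin.sum_univ_three]
    · simp only [Fin.sum_univ_three, Matrix.cons_val, panelChart_eq]
      module
  · rintro _ ⟨i, rfl⟩
    fin_cases i
    · exact ⟨![0, 0], by norm_num [refPanel], by simp [panelChart_eq]⟩
    · exact ⟨![1, 0], by norm_num [refPanel], by simp [panelChart_eq]⟩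
    · exact ⟨![1, 1], by norm_num [refPanel], by simp [panelChart_eq]⟩
  · rintro _ ⟨x, ⟨h1, h2, h3⟩, rfl⟩ _ ⟨y, ⟨k1, k2, k3⟩, rfl⟩ a b ha hb hab
    refine ⟨a • x + b • y, ⟨?_, ?_, ?_⟩, ?_⟩
    · simp only [Pi.add_apply, Pi.smul_apply, smul_eq_mul]
      positivity
    · simp only [Pi.add_apply, Pi.smul_apply, smul_eq_mul]
      nlinarith
    · simp only [Pi.add_apply, Pi.smul_apply, smul_eq_mul]
      nlinarith
    · obtain rfl : b = 1 - a := by linarith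
      simp only [panelChart_eq, Pi.add_apply, Pi.smul_apply, smul_eq_mul]
      module

/-- The Hausdorff measure on the image of an affine chart. -/
theorem euclideanHausdorffMeasure_restrict_image {k : ℕ} (M : Matrix (Fin 3) (Fin k) ℝ) (c : E3)
    {g : (Fin k → ℝ) → E3} (hg : g = fun x => WithLp.toLp 2 (M.mulVec x) + c) (S : Set (Fin k → ℝ)) :
    (Measure.euclideanHausdorffMeasure k).restrict (g '' S) =
      ENNReal.ofReal (Matrix.toEuclideanLin M).normDet • (volume.restrict S).map g := by
  have hgm : Measurable g := by
    rw [hg]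
    fun_prop
  -- Translation is an isometry and a linear map scales `k`-dimensional Hausdorff measure by its
  -- `normDet`. A degenerate `M` is covered as well.
  have himg : ∀ B, Measure.euclideanHausdorffMeasure k (g '' B) =
      ENNReal.ofReal (Matrix.toEuclideanLin M).normDet * volume B := by
    intro B
    have h1 : g '' B = (fun v => v + c) ''
        (Matrix.toEuclideanLin M '' (WithLp.toLp 2 '' B)) := by
      rw [image_image, image_image, hg]
      rfl
    have h2 := (Matrix.toEuclideanLin M).euclideanHausdorffMeasure_image_eq_normDet_mul_volume
      (WithLp.toLp 2 '' B)
    rw [finrank_euclideanSpace_fin] at h2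
    rw [h1, (isometry_add_right c).euclideanHausdorffMeasure_image, h2]
    congr 1
    have h3 := (PiLp.volume_preserving_toLp (Fin k)).measure_preimage_emb
      (MeasurableEquiv.toLp 2 (Fin k → ℝ)).measurableEmbedding (WithLp.toLp 2 '' B)
    rw [← h3, preimage_image_eq _ (WithLp.toLp_injective 2)]
  ext A hA
  rw [Measure.restrict_apply hA, Measure.smul_apply, Measure.map_apply hgm hA,
    Measure.restrict_apply (hgm hA), ← image_preimage_inter, himg, smul_eq_mul]

theorem normDet_toEuclideanLin_sq {k : ℕ} (M : Matrix (Fin 3) (Fin k) ℝ) :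
    (Matrix.toEuclideanLin M).normDet ^ 2 = (M.transpose * M).det := by
  have := (Matrix.toEuclideanLin M).normDet_sq_eq_det_gram (EuclideanSpace.basisFun (Fin k) ℝ)
  rw [RCLike.ofReal_real_eq_id, id] at this
  rw [this]
  congr 1
  ext i j
  simp [Matrix.gram_apply, Matrix.mul_apply, PiLp.inner_apply, mul_comm]

theorem normDet_tetraMat (t : Fin 4 → E3) :
    (Matrix.toEuclideanLin (tetraMat t)).normDet = |(tetraMat t).det| := by
  rw [← sq_eq_sq₀ (LinearMap.normDet_nonneg _) (abs_nonneg _), normDet_toEuclideanLin_sq, sq_abs,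
    Matrix.det_mul, Matrix.det_transpose, sq]

/-- Lagrange's identity: the Gram determinant `|u|²|v|² - (u·v)²` of the two edge vectors equals `|u
× v|²`. -/
theorem normDet_panelMat (τ : Fin 3 → E3) :
    (Matrix.toEuclideanLin (panelMat τ)).normDet = panelDet τ := by
  rw [panelDet, ← sq_eq_sq₀ (LinearMap.normDet_nonneg _) (norm_nonneg _), normDet_toEuclideanLin_sq,
    EuclideanSpace.norm_sq_eq]
  simp [Matrix.det_fin_two, Matrix.mul_apply, Fin.sum_univ_three, panelMat, crossProduct]
  ring

/-- In top dimension the normalised Hausdorff measure is Lebesgue measure, so one lemma serves both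
tetrahedron and panel. -/
theorem volume_restrict_tetra (t : Fin 4 → E3) :
    volume.restrict (tetra t) =
      ENNReal.ofReal |(tetraMat t).det| • (volume.restrict refTetra).map (tetraChart t) := by
  rw [← tetraChart_image, ← EuclideanSpace.euclideanHausdorffMeasure_eq_volume,
    euclideanHausdorffMeasure_restrict_image (g := tetraChart t) (tetraMat t) (t 0) rfl,
    normDet_tetraMat]

theorem panelMeasure_eq (τ : Fin 3 → E3) :
    panelMeasure τ =
      ENNReal.ofReal (panelDet τ) • (volume.restrict refPanel).map (panelChart τ) := by
  rw [panelMeasure, ← panelChart_image,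
    euclideanHausdorffMeasure_restrict_image (g := panelChart τ) (panelMat τ) (τ 0) rfl,
    normDet_panelMat]

/-! ### The pulled-back kernel: integrability, homogeneity, continuity. -/

theorem continuous_affFun (α : Fin 4 → ℝ) : Continuous (affFun α) := by
  unfold affFun
  fun_prop

theorem measurable_k2 {φ ψ : E3 → ℝ} (hφ : Continuous φ) (hψ : Continuous ψ) (s : ℝ) (n : E3) :
    Measurable fun p : E3 × E3 => k2 s φ ψ n p.1 p.2 := by
  unfold k2
  have h1 : Measurable fun p : E3 × E3 => φ p.1 := hφ.measurable.comp measurable_fst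
  have h2 : Measurable fun p : E3 × E3 => ψ p.1 := hψ.measurable.comp measurable_fst
  have h3 : Measurable fun p : E3 × E3 => inner ℝ (p.2 - p.1) n := by
    apply Continuous.measurable
    fun_prop
  have h4 : Measurable fun p : E3 × E3 => ‖p.1 - p.2‖ := by
    apply Continuous.measurable
    fun_prop
  exact (h1.mul h2).mul (h3.div (h4.pow_const _))

theorem measurable_k2Ref (s : ℝ) (α β : Fin 4 → ℝ) (n : E3) (t : Fin 4 → E3) (τ : Fin 3 → E3) :
    Measurable (k2Ref s α β n t τ) := by
  have h := (measurable_k2 (continuous_affFun α) (continuous_affFun β) s n).comp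
    (((continuous_tetraChart t).measurable.comp measurable_fst).prodMk
      ((continuous_panelChart τ).measurable.comp (measurable_snd (α := Fin 3 → ℝ))))
  exact (h.mul_const _).mul_const _

/-- Pull the singular integral back to the reference elements. -/
theorem singularIntegral_eq_ref {s : ℝ} {t : Fin 4 → E3} {τ : Fin 3 → E3} {n : E3}
    {φ ψ : E3 → ℝ} (hφ : Continuous φ) (hψ : Continuous ψ) {α β : Fin 4 → ℝ}
    (hα : Set.EqOn φ (affFun α) (tetra t)) (hβ : Set.EqOn ψ (affFun β) (tetra t))
    (hint : IntegrableOn (k2Ref s α β n t τ) (refTetra ×ˢ refPanel)) :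
    Integrable (fun p : E3 × E3 => k2 s φ ψ n p.1 p.2)
      ((volume.restrict (tetra t)).prod (panelMeasure τ)) ∧
    singularIntegral s φ ψ n t τ = ∫ q in refTetra ×ˢ refPanel, k2Ref s α β n t τ q := by
  have hm := measurable_k2 hφ hψ s n
  have hχt := (continuous_tetraChart t).measurable
  have hχτ := (continuous_panelChart τ).measurable
  have hχ := hχt.prodMap hχτ
  have hμ : (volume.restrict (tetra t)).prod (panelMeasure τ) =
      (ENNReal.ofReal |(tetraMat t).det| * ENNReal.ofReal (panelDet τ)) •
        (volume.restrict (refTetra ×ˢ refPanel)).map (Prod.map (tetraChart t) (panelChart τ)) := by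
    rw [volume_restrict_tetra t, panelMeasure_eq τ, Measure.prod_smul_left,
      Measure.prod_smul_right, Measure.map_prod_map _ _ hχt hχτ, Measure.prod_restrict, smul_smul]
    rfl
  have heq : ∀ᵐ q ∂(volume.restrict (refTetra ×ˢ refPanel)), k2Ref s α β n t τ q =
      (|(tetraMat t).det| * panelDet τ) *
        k2 s φ ψ n (tetraChart t q.1) (panelChart τ q.2) := by
    filter_upwards [ae_restrict_mem (measurableSet_refTetra.prod measurableSet_refPanel)] with q hq
    have hmem : tetraChart t q.1 ∈ tetra t := tetraChart_image t ▸ mem_image_of_mem _ hq.1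
    simp only [k2Ref, k2, hα hmem, hβ hmem]
    ring
  have hpd : 0 ≤ panelDet τ := norm_nonneg _
  have h1 : Integrable (fun p : E3 × E3 => k2 s φ ψ n p.1 p.2)
      ((volume.restrict (tetra t)).prod (panelMeasure τ)) := by
    rw [hμ]
    -- Nondegeneracy is not assumed here; if the Jacobian factor vanishes, the product measure is
    -- zero.
    rcases eq_or_ne (|(tetraMat t).det| * panelDet τ) 0 with h0 | h0
    · rw [← ENNReal.ofReal_mul (abs_nonneg _), h0, ENNReal.ofReal_zero, zero_smul]
      exact integrable_zero_measure
    · refine Integrable.smul_measure ?_ (ENNReal.mul_ne_top ENNReal.ofReal_ne_top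
        ENNReal.ofReal_ne_top)
      rw [integrable_map_measure hm.aestronglyMeasurable hχ.aemeasurable]
      refine (Integrable.const_mul hint (|(tetraMat t).det| * panelDet τ)⁻¹).congr ?_
      filter_upwards [heq] with q hq
      rw [hq, inv_mul_cancel_left₀ h0]
      rfl
  have hfin : SFinite (panelMeasure τ) := by
    rw [panelMeasure_eq τ]
    infer_instance
  refine ⟨h1, ?_⟩
  rw [singularIntegral, integral_integral h1, hμ, integral_smul_measure,
    integral_map hχ.aemeasurable hm.aestronglyMeasurable, integral_congr_ae heq,
    integral_const_mul, ENNReal.toReal_mul, ENNReal.toReal_ofReal (abs_nonneg _),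
    ENNReal.toReal_ofReal hpd]
  rfl

/-- The open set where one of the functions is nonzero lies in the union of the supports, hence in
its interior, which the frontier avoids. -/
theorem eq_zero_of_mem_frontier_tsupport_union {X : Type*} [TopologicalSpace X] {φ ψ : X → ℝ}
    (hφ : Continuous φ) (hψ : Continuous ψ) {x : X} (hx : x ∈ frontier (tsupport φ ∪ tsupport ψ)) :
    φ x = 0 ∧ ψ x = 0 := by
  have hi : x ∉ interior (tsupport φ ∪ tsupport ψ) := hx.2
  constructor
  · by_contra h
    refine hi (mem_interior.mpr ⟨{y | φ y ≠ 0}, fun y hy => Or.inl (subset_tsupport _ hy), ?_, h⟩)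
    exact isOpen_ne_fun hφ continuous_const
  · by_contra h
    refine hi (mem_interior.mpr ⟨{y | ψ y ≠ 0}, fun y hy => Or.inr (subset_tsupport _ hy), ?_, h⟩)
    exact isOpen_ne_fun hψ continuous_const

/-- Written in vertex values, the function visibly becomes linear in `x` once it vanishes at `t 0`,
independent of `x 0` if also at `t 1`, and a multiple of `x 2` if also at `t 2`. -/
theorem affFun_tetraChart (α : Fin 4 → ℝ) (t : Fin 4 → E3) (x : Fin 3 → ℝ) :
    affFun α (tetraChart t x) = x 0 * (affFun α (t 1) - affFun α (t 0)) +
      x 1 * (affFun α (t 2) - affFun α (t 1)) + x 2 * (affFun α (t 3) - affFun α (t 1)) +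
      affFun α (t 0) := by
  rw [tetraChart_eq]
  simp [affFun]
  ring

/-- Homogeneity of the pulled-back integrand. -/
theorem k2Ref_scale {s : ℝ} {α β : Fin 4 → ℝ} {n : E3} {t : Fin 4 → E3} {τ : Fin 3 → E3}
    {p q : (Fin 3 → ℝ) × (Fin 2 → ℝ)} {r : ℝ} (hr : 0 < r)
    (hα : affFun α (tetraChart t p.1) = r * affFun α (tetraChart t q.1))
    (hβ : affFun β (tetraChart t p.1) = r * affFun β (tetraChart t q.1))
    (hd : panelChart τ p.2 - tetraChart t p.1 = r • (panelChart τ q.2 - tetraChart t q.1)) :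
    k2Ref s α β n t τ p = r ^ (-2 * s) * k2Ref s α β n t τ q := by
  simp only [k2Ref, k2]
  rw [hα, hβ, norm_sub_rev (tetraChart t p.1), hd, norm_sub_rev (tetraChart t q.1),
    inner_smul_left, norm_smul, Real.norm_of_nonneg hr.le, Real.mul_rpow hr.le (norm_nonneg _)]
  -- The factor `r ^ 3` cancels against one `r` from each affine function and one from the inner
  -- product.
  have h1 : r ^ (3 + 2 * s) = r ^ 3 * r ^ (2 * s) := by
    rw [Real.rpow_add hr, show (3 : ℝ) = (3 : ℕ) by norm_num, Real.rpow_natCast]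
  have h2 : r ^ (-2 * s) = (r ^ (2 * s))⁻¹ := by rw [neg_mul, Real.rpow_neg hr.le]
  have h3 : 0 < r ^ (2 * s) := Real.rpow_pos_of_pos hr _
  rw [h1, h2, div_eq_mul_inv, div_eq_mul_inv, mul_inv, mul_inv]
  simp only [conj_trivial]
  field_simp

theorem continuousAt_k2Ref (s : ℝ) (α β : Fin 4 → ℝ) (n : E3) {t : Fin 4 → E3} {τ : Fin 3 → E3}
    {q : (Fin 3 → ℝ) × (Fin 2 → ℝ)} (hq : tetraChart t q.1 ≠ panelChart τ q.2) :
    ContinuousAt (k2Ref s α β n t τ) q := by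
  have h1 : ContinuousAt (fun p : (Fin 3 → ℝ) × (Fin 2 → ℝ) => tetraChart t p.1) q :=
    ((continuous_tetraChart t).comp continuous_fst).continuousAt
  have h2 : ContinuousAt (fun p : (Fin 3 → ℝ) × (Fin 2 → ℝ) => panelChart τ p.2) q :=
    ((continuous_panelChart τ).comp continuous_snd).continuousAt
  have hpos : 0 < ‖tetraChart t q.1 - panelChart τ q.2‖ := norm_pos_iff.mpr (sub_ne_zero.mpr hq)
  unfold k2Ref k2
  refine ((((continuous_affFun α).continuousAt.comp h1).mul
    ((continuous_affFun β).continuousAt.comp h1)).mul (((h2.sub h1).inner continuousAt_const).div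
      ((h1.sub h2).norm.rpow_const (Or.inl hpos.ne')) ?_)).mul_const _ |>.mul_const _
  exact (Real.rpow_pos_of_pos hpos _).ne'

theorem continuousOn_k2Ref_comp {Y : Type*} [TopologicalSpace Y] {s : ℝ} {α β : Fin 4 → ℝ} {n : E3}
    {t : Fin 4 → E3} {τ : Fin 3 → E3} {D : Y → (Fin 3 → ℝ) × (Fin 2 → ℝ)} (hD : Continuous D)
    {S : Set Y} (h : ∀ η ∈ S, tetraChart t (D η).1 ≠ panelChart τ (D η).2) :
    ContinuousOn (fun η => k2Ref s α β n t τ (D η)) S := fun η hη =>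
  ((continuousAt_k2Ref s α β n (h η hη)).comp hD.continuousAt).continuousWithinAt

/-! ### The charts do not meet at the points `D_m(η)`. -/

/-- `D_m(η)` lies in the reference elements, so a coincidence of the charts would be the shared
vertex. Injectivity would make both components zero, yet one of them has leading entry `1`. -/
theorem chart_ne_vertex {t : Fin 4 → E3} (ht : AffineIndependent ℝ t) {τ : Fin 3 → E3}
    (hτ : AffineIndependent ℝ τ) (h0 : t 0 = τ 0) (hcap : tetra t ∩ panel τ = {t 0}) (m : Fin 2)
    {η : Fin 4 → ℝ} (hη : η ∈ Icc (0 : Fin 4 → ℝ) 1) :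
    tetraChart t (duffyVertex η m).1 ≠ panelChart τ (duffyVertex η m).2 := by
  intro h
  have hl : ∀ i, 0 ≤ η i := hη.1
  have hu : ∀ i, η i ≤ 1 := hη.2
  have hmul : ∀ i j, η i * η j ≤ 1 := fun i j => mul_le_one₀ (hu i) (hl j) (hu j)
  have hm : (duffyVertex η m).1 ∈ refTetra ∧ (duffyVertex η m).2 ∈ refPanel := by
    have l0 := hl 0
    have l1 := hl 1
    have l2 := hl 2
    have l3 := hl 3
    have u0 := hu 0
    have u1 := hu 1
    have u2 := hu 2
    have u3 := hu 3
    fin_cases m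
    · simp [duffyVertex, refTetra, refPanel]
      refine ⟨⟨?_, ?_, ?_⟩, ?_, ?_, ?_⟩ <;> nlinarith [hmul 0 1]
    · simp [duffyVertex, refTetra, refPanel]
      have h12 : 0 ≤ η 1 * η 2 := mul_nonneg (hl 1) (hl 2)
      refine ⟨⟨?_, ?_, ?_, ?_⟩, ?_, ?_⟩ <;> nlinarith
  have hmem : tetraChart t (duffyVertex η m).1 ∈ tetra t ∩ panel τ :=
    ⟨tetraChart_image t ▸ mem_image_of_mem _ hm.1,
      h ▸ panelChart_image τ ▸ mem_image_of_mem _ hm.2⟩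
  rw [hcap, mem_singleton_iff] at hmem
  have e1 := tetraChart_injective ht (hmem.trans
    (show t 0 = tetraChart t 0 by simp [tetraChart_eq]))
  have e2 := panelChart_injective hτ ((h.symm.trans (hmem.trans h0)).trans
    (show τ 0 = panelChart τ 0 by simp [panelChart_eq]))
  have e1' := congrFun e1 0
  have e2' := congrFun e2 0
  fin_cases m <;> simp [duffyVertex] at e1' e2'

/-- `D_m(η)` itself may leave the reference elements; this point is the full transformation at `ξ₁ =
ξ₂ = 1`. -/
theorem refB_add_duffyEdge_mem (m : Fin 4) {η : Fin 3 → ℝ} (hη : η ∈ Icc (0 : Fin 3 → ℝ) 1) :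
    refB + duffyEdge η m ∈ refTetra ×ˢ refPanel := by
  have hl : ∀ i, 0 ≤ η i := hη.1
  have hu : ∀ i, η i ≤ 1 := hη.2
  have h0 := hl 0
  have h1 := hl 1
  have h2 := hl 2
  have k0 := hu 0
  have k1 := hu 1
  have k2 := hu 2
  have h12 := mul_nonneg h1 h2
  have h01 := mul_nonneg h0 h1
  fin_cases m <;> simp [refB, duffyEdge, refTetra, refPanel]
  · refine ⟨⟨?_, ?_⟩, ?_, ?_, ?_⟩ <;> nlinarith
  · refine ⟨⟨?_, ?_, ?_⟩, ?_, ?_⟩ <;> nlinarith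
  · refine ⟨⟨?_, ?_, ?_, ?_⟩, ?_, ?_⟩ <;> nlinarith
  · refine ⟨?_, ?_, ?_, ?_⟩ <;> nlinarith [mul_nonneg h01 h2]

/-- Adding `refB` moves both chart values by the same vector `b - a`, so a coincidence would give a
common point of `t` and `τ`. It lies on the shared edge, forcing `D_m(η)` to be a multiple of
`refB`, which no `D_m(η)` in the cube is. -/
theorem chart_ne_edge {t : Fin 4 → E3} (ht : AffineIndependent ℝ t) {τ : Fin 3 → E3}
    (hτ : AffineIndependent ℝ τ) (h0 : t 0 = τ 0) (h1 : t 1 = τ 1)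
    (hcap : tetra t ∩ panel τ = segment ℝ (t 0) (t 1)) (m : Fin 4)
    {η : Fin 3 → ℝ} (hη : η ∈ Icc (0 : Fin 3 → ℝ) 1) :
    tetraChart t (duffyEdge η m).1 ≠ panelChart τ (duffyEdge η m).2 := by
  intro h
  have hm := refB_add_duffyEdge_mem m hη
  have ha : tetraChart t (refB + duffyEdge η m).1 =
      tetraChart t (duffyEdge η m).1 + (t 1 - t 0) := by
    simp only [tetraChart_eq, refB, Prod.fst_add, Pi.add_apply, Matrix.cons_val]
    module
  have hb : panelChart τ (refB + duffyEdge η m).2 =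
      panelChart τ (duffyEdge η m).2 + (τ 1 - τ 0) := by
    simp only [panelChart_eq, refB, Prod.snd_add, Pi.add_apply, Matrix.cons_val]
    module
  have hab : tetraChart t (refB + duffyEdge η m).1 = panelChart τ (refB + duffyEdge η m).2 := by
    rw [ha, hb, h, h0, h1]
  have hmem : tetraChart t (refB + duffyEdge η m).1 ∈ tetra t ∩ panel τ :=
    ⟨tetraChart_image t ▸ mem_image_of_mem _ hm.1,
      hab ▸ panelChart_image τ ▸ mem_image_of_mem _ hm.2⟩
  rw [hcap, segment_eq_image'] at hmem
  obtain ⟨θ, -, hθ⟩ := hmem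
  have e1 := tetraChart_injective ht (hθ.symm.trans
    (show t 0 + θ • (t 1 - t 0) = tetraChart t ![θ, 0, 0] by simp [tetraChart_eq, add_comm]))
  have e2 := panelChart_injective hτ ((hab.symm.trans hθ.symm).trans
    (show t 0 + θ • (t 1 - t 0) = panelChart τ ![θ, 0] by
      simp [panelChart_eq, add_comm, h0, h1]))
  have e10 := congrFun e1 0
  have e11 := congrFun e1 1
  have e12 := congrFun e1 2
  have e20 := congrFun e2 0
  have e21 := congrFun e2 1
  fin_cases m <;> simp [refB, duffyEdge] at e10 e11 e12 e20 e21 <;> grind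

/-- The panel's directions are directions of the tetrahedron, so a coincidence becomes a linear
relation among three independent vectors. Its coefficients cannot all vanish, for any real `η`, so
no intersection hypothesis is needed. -/
theorem chart_ne_face {t : Fin 4 → E3} (ht : AffineIndependent ℝ t) {τ : Fin 3 → E3}
    (h0 : t 0 = τ 0) (h1 : t 1 = τ 1) (h2 : t 2 = τ 2) (m : Fin 9) (η : Fin 2 → ℝ) :
    tetraChart t (duffyFace η m).1 ≠ panelChart τ (duffyFace η m).2 := by
  intro h
  obtain ⟨e0, e1, e2⟩ := tetra_lin_indep ht
    (a := (duffyFace η m).1 0 - (duffyFace η m).2 0)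
    (b := (duffyFace η m).1 1 - (duffyFace η m).2 1) (c := (duffyFace η m).1 2) (by
      rw [tetraChart_eq, panelChart_eq, ← sub_eq_zero, ← h0, ← h1, ← h2] at h
      rw [← h]
      module)
  fin_cases m <;> simp [duffyFace] at e0 e1 e2 <;> grind

end DuffyPanel

end

theorem mainTheorem6
    (s : ℝ) (hs0 : 0 < s) (hs1 : s < 1)
    (t : Fin 4 → DuffyPanel.E3) (ht : AffineIndependent ℝ t)
    (τ : Fin 3 → DuffyPanel.E3) (hτ : AffineIndependent ℝ τ)
    (n : DuffyPanel.E3) (hn : ‖n‖ = 1) (hnτ : ∀ k : Fin 3, inner ℝ (τ k - τ 0) n = 0)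
    (φ ψ : DuffyPanel.E3 → ℝ) (hφ : Continuous φ) (hψ : Continuous ψ)
    (α β : Fin 4 → ℝ)
    (hα : Set.EqOn φ (DuffyPanel.affFun α) (DuffyPanel.tetra t))
    (hβ : Set.EqOn ψ (DuffyPanel.affFun β) (DuffyPanel.tetra t))
    (hsupp : DuffyPanel.panel τ ⊆ frontier (tsupport φ ∪ tsupport ψ)) :
    -- common vertex
    (t 0 = τ 0 → DuffyPanel.tetra t ∩ DuffyPanel.panel τ = {t 0} →
      MeasureTheory.Integrable
          (fun p : DuffyPanel.E3 × DuffyPanel.E3 => DuffyPanel.k2 s φ ψ n p.1 p.2)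
          ((MeasureTheory.volume.restrict (DuffyPanel.tetra t)).prod (DuffyPanel.panelMeasure τ)) ∧
        ContinuousOn (DuffyPanel.k2Vertex s α β n t τ) (Set.Icc 0 1) ∧
        DuffyPanel.singularIntegral s φ ψ n t τ =
          (1 / (5 - 2 * s)) *
            ∫ η in Set.Icc (0 : Fin 4 → ℝ) 1, DuffyPanel.k2Vertex s α β n t τ η) ∧
    -- common edge
    (t 0 = τ 0 → t 1 = τ 1 →
      DuffyPanel.tetra t ∩ DuffyPanel.panel τ = segment ℝ (t 0) (t 1) →
      MeasureTheory.Integrable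
          (fun p : DuffyPanel.E3 × DuffyPanel.E3 => DuffyPanel.k2 s φ ψ n p.1 p.2)
          ((MeasureTheory.volume.restrict (DuffyPanel.tetra t)).prod (DuffyPanel.panelMeasure τ)) ∧
        ContinuousOn (DuffyPanel.k2Edge s α β n t τ) (Set.Icc 0 1) ∧
        DuffyPanel.singularIntegral s φ ψ n t τ =
          (1 / (5 - 2 * s)) * (1 / (4 - 2 * s)) *
            ∫ η in Set.Icc (0 : Fin 3 → ℝ) 1, DuffyPanel.k2Edge s α β n t τ η) ∧
    -- the panel is a face of the tetrahedron
    (t 0 = τ 0 → t 1 = τ 1 → t 2 = τ 2 →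
      MeasureTheory.Integrable
          (fun p : DuffyPanel.E3 × DuffyPanel.E3 => DuffyPanel.k2 s φ ψ n p.1 p.2)
          ((MeasureTheory.volume.restrict (DuffyPanel.tetra t)).prod (DuffyPanel.panelMeasure τ)) ∧
        ContinuousOn (DuffyPanel.k2Face s α β n t τ) (Set.Icc 0 1) ∧
        DuffyPanel.singularIntegral s φ ψ n t τ =
          (∏ j ∈ Finset.range 3, 1 / (5 - (j : ℝ) - 2 * s)) *
            ∫ η in Set.Icc (0 : Fin 2 → ℝ) 1, DuffyPanel.k2Face s α β n t τ η) := by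
  -- The support condition enters only here: it makes both affine expressions vanish at each shared
  -- vertex, which yields the homogeneity used in all three cases.
  have hz : ∀ k i, t i = τ k → DuffyPanel.affFun α (t i) = 0 ∧ DuffyPanel.affFun β (t i) = 0 := by
    intro k i h
    have hτk : τ k ∈ DuffyPanel.panel τ := subset_convexHull ℝ _ (Set.mem_range_self k)
    have hti : t i ∈ DuffyPanel.tetra t := subset_convexHull ℝ _ (Set.mem_range_self i)
    have := DuffyPanel.eq_zero_of_mem_frontier_tsupport_union hφ hψ (hsupp hτk)
    rw [← hα hti, ← hβ hti, h]
    exact this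
  have hmeas := DuffyPanel.measurable_k2Ref s α β n t τ
  refine ⟨fun h0 hcap => ?_, fun h0 h1 hcap => ?_, fun h0 h1 h2 => ?_⟩
  · obtain ⟨hα0, hβ0⟩ := hz 0 0 h0
    obtain ⟨hint, hcont, heq⟩ := DuffyPanel.integral_ref_vertex hs1 hmeas
      (fun r hr q => DuffyPanel.k2Ref_scale hr
        (by simp [DuffyPanel.affFun_tetraChart, hα0]; ring)
        (by simp [DuffyPanel.affFun_tetraChart, hβ0]; ring)
        (by
          simp only [DuffyPanel.tetraChart_eq, DuffyPanel.panelChart_eq, Prod.smul_fst,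
            Prod.smul_snd, Pi.smul_apply, smul_eq_mul, h0]
          module))
      (fun m => DuffyPanel.continuousOn_k2Ref_comp (DuffyPanel.continuous_duffyVertex m)
        fun η hη => DuffyPanel.chart_ne_vertex ht hτ h0 hcap m hη)
    obtain ⟨h1, h2⟩ := DuffyPanel.singularIntegral_eq_ref hφ hψ hα hβ hint
    exact ⟨h1, hcont, h2.trans heq⟩
  · obtain ⟨hα0, hβ0⟩ := hz 0 0 h0
    obtain ⟨hα1, hβ1⟩ := hz 1 1 h1
    obtain ⟨hint, hcont, heq⟩ := DuffyPanel.integral_ref_edge hs1 hmeas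
      (fun a r hr q => DuffyPanel.k2Ref_scale hr
        (by
          simp only [DuffyPanel.affFun_tetraChart, hα0, hα1, DuffyPanel.refB, Prod.smul_fst,
            Prod.fst_add, Pi.add_apply, Pi.smul_apply, Matrix.cons_val, smul_eq_mul]
          ring)
        (by
          simp only [DuffyPanel.affFun_tetraChart, hβ0, hβ1, DuffyPanel.refB, Prod.smul_fst,
            Prod.fst_add, Pi.add_apply, Pi.smul_apply, Matrix.cons_val, smul_eq_mul]
          ring)
        (by
          simp only [DuffyPanel.tetraChart_eq, DuffyPanel.panelChart_eq, DuffyPanel.refB,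
            Prod.smul_fst, Prod.smul_snd, Prod.fst_add, Prod.snd_add, Pi.add_apply, Pi.smul_apply,
            Matrix.cons_val, smul_eq_mul, h0, h1]
          module))
      (fun m => DuffyPanel.continuousOn_k2Ref_comp (DuffyPanel.continuous_duffyEdge m)
        fun η hη => DuffyPanel.chart_ne_edge ht hτ h0 h1 hcap m hη)
    obtain ⟨h1, h2⟩ := DuffyPanel.singularIntegral_eq_ref hφ hψ hα hβ hint
    exact ⟨h1, hcont, h2.trans heq⟩
  · obtain ⟨hα0, hβ0⟩ := hz 0 0 h0
    obtain ⟨hα1, hβ1⟩ := hz 1 1 h1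
    obtain ⟨hα2, hβ2⟩ := hz 2 2 h2
    obtain ⟨hint, hcont, heq⟩ := DuffyPanel.integral_ref_face hs1 hmeas
      (fun a b r hr q => DuffyPanel.k2Ref_scale hr
        (by
          simp only [DuffyPanel.affFun_tetraChart, hα0, hα1, hα2, DuffyPanel.refB,
            DuffyPanel.refC, Prod.smul_fst, Prod.fst_add, Pi.add_apply, Pi.smul_apply,
            Matrix.cons_val, smul_eq_mul]
          ring)
        (by
          simp only [DuffyPanel.affFun_tetraChart, hβ0, hβ1, hβ2, DuffyPanel.refB,
            DuffyPanel.refC, Prod.smul_fst, Prod.fst_add, Pi.add_apply, Pi.smul_apply,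
            Matrix.cons_val, smul_eq_mul]
          ring)
        (by
          simp only [DuffyPanel.tetraChart_eq, DuffyPanel.panelChart_eq, DuffyPanel.refB,
            DuffyPanel.refC, Prod.smul_fst, Prod.smul_snd, Prod.fst_add, Prod.snd_add,
            Pi.add_apply, Pi.smul_apply, Matrix.cons_val, smul_eq_mul, h0, h1, h2]
          module))
      (fun m => DuffyPanel.continuousOn_k2Ref_comp (DuffyPanel.continuous_duffyFace m)
        fun η _ => DuffyPanel.chart_ne_face ht h0 h1 h2 m η)
    obtain ⟨h3, h4⟩ := DuffyPanel.singularIntegral_eq_ref hφ hψ hα hβ hint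
    refine ⟨h3, hcont, (h4.trans heq).trans ?_⟩
    congr 1
    norm_num [Finset.prod_range_succ]
    ring
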